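/- Let $\mathfrak t\cong\mathbb R^2$, and let $\Delta\subset\mathfrak t^*$ be a convex quadrilateral with vertices $s_1,\dots,s_4$ in cyclic order and edges $F_1,\dots,F_4$. An inward normal $u=(u_1,\dots,u_4)$ consists of vectors $u_i\in\mathfrak t$ normal to $F_i$ and pointing into $\Delta$; write $L_i$ for the affine function with $dL_i=u_i$ and $L_i=0$ on $F_i$. The labelled polytope $(\Delta,u)$ is monotone if $L_1(p)=\dots=L_4(p)$ for some $p\in\Delta$. A linear function $a\in\mathfrak t$ is equipoised if $\sum_{i=1}^4(-1)^i\langle s_i,a\rangle=0$. A symplectic potential of $(\Delta,u)$ is a smooth function $\phi$ on $\mathring\Delta$ with positive definite Hessian such that $\mathbf H=(\mathrm{Hess}\,\phi)^{-1}$ extends smoothly to $\Delta$ and, for $y$ in the interior of $F_i$, $\mathbf H_y(u_i,\cdot)=0$, $d\mathbf H_y(u_i,u_i)=2u_i$, and $\mathbf H_y(v,v)>0$ for all $v\notin\mathbb R u_i$. It defines on $\mathring\Delta\times\mathbb R^2$, with coordinates $(\mu_1,\mu_2,t_1,t_2)$, the Kähler metric $g=\sum_{i,j}(\mathrm{Hess}\,\phi)_{ij}\,d\mu_i\,d\mu_j+\mathbf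 H_{ij}\,dt_i\,dt_j$ with Kähler form $\omega=\sum_i d\mu_i\wedge dt_i$ and complex structure $J$, where $\omega(X,Y)=g(JX,Y)$. The pair $(g,a)$ is a generalized Kähler--Ricci soliton on $(\Delta,u)$ if $Scal-\overline{Scal}=2\Delta^g\langle\mu,a\rangle$ on $\mathring\Delta$, where $Scal=-\sum_{i,j}\partial^2\mathbf H_{ij}/\partial\mu_i\partial\mu_j$, $\overline{Scal}$ is the mean of $Scal$ over $\Delta$, and $\Delta^g\langle\mu,a\rangle=-\sum_{i,j}a_j\,\partial\mathbf H_{ij}/\partial\mu_i$. The metric $g$ has a Hamiltonian $2$-form if there is a smooth, $J$-invariant $2$-form $\Phi$ on $\mathring\Delta\times\mathbb R^2$, with components independent of $t$, which is not a constant multiple of $\omega$ and satisfies $$\nabla_X\Phi=\tfrac12\left(d\sigma\wedge (JX)^\flat-Jd\sigma\wedge X^\flat\right)\quad\text{for all }X,$$ where $\sigma=\langle\Phi,\omega\rangle$ (normalized so that $\langle\omega,\omega\rangle=2$) and $(J\alpha)(Y)=-\alpha(JY)$. Fix reference inward normals $\nu$; every inward normal of $\Delta$ is $u_i=w_i^{-1}\nu_i$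 with unique $w_i>0$. A $d$-dimensional cone of inward normals is a nonempty set of all the $u$ whose vector $w=(w_1,\dots,w_4)$ lies in a given $d$-dimensional linear subspace of $\mathbb R^4$ (this notion does not depend on $\nu$). **Proposition.** For every convex quadrilateral $\Delta$ and every equipoised linear function $a\in\mathfrak t$ there is a $2$-dimensional cone $C$ of inward normals such that for each $u\in C$ the labelled polytope $(\Delta,u)$ admits a generalized Kähler--Ricci soliton $(g,a)$ with a Hamiltonian $2$-form. Moreover, the $u\in C$ for which $(\Delta,u)$ is monotone form a $1$-dimensional (that is, codimension $1$) cone of inward normals. -/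

import Mathlib

open scoped Matrix ContDiff

noncomputable section

namespace ToricKR

/-! ### Riemannian and Kähler geometry in a coordinate chart

Tensors on an open subset of `ι → ℝ` are given by their components in the standard coordinates. -/

section Chart

variable {ι : Type*} [Fintype ι] [DecidableEq ι]

/-- The partial derivative `∂f/∂xᵢ` at `p`. -/
def partialDeriv (i : ι) (f : (ι → ℝ) → ℝ) (p : ι → ℝ) : ℝ :=
  fderiv ℝ f p (Pi.single i 1)

/-- The Hessian matrix of `f`. -/
def hess (f : (ι → ℝ) → ℝ) (p : ι → ℝ) : Matrix ι ι ℝ :=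
  Matrix.of fun i j => partialDeriv i (partialDeriv j f) p

/-- The Christoffel symbol `Γᵏᵢⱼ` of the Levi-Civita connection of the metric `g`. -/
def christoffel (g : (ι → ℝ) → Matrix ι ι ℝ) (p : ι → ℝ) (k i j : ι) : ℝ :=
  (1 / 2) * ∑ l, (g p)⁻¹ k l *
    (partialDeriv i (fun q => g q j l) p + partialDeriv j (fun q => g q i l) p
      - partialDeriv l (fun q => g q i j) p)

/-- The components `(∇ₖ Φ)ᵢⱼ` of the Levi-Civita covariant derivative of a 2-tensor `Φ`. -/
def covDeriv (g Φ : (ι → ℝ) → Matrix ι ι ℝ) (p : ι → ℝ) (k i j : ι) : ℝ :=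
  partialDeriv k (fun q => Φ q i j) p
    - ∑ l, christoffel g p l k i * Φ p l j - ∑ l, christoffel g p l k j * Φ p i l

/-- The endomorphism `J` with `Om(X, Y) = g(JX, Y)`; column `c` holds the components of `J ∂_c`. -/
def complexStructure (g Om : (ι → ℝ) → Matrix ι ι ℝ) (p : ι → ℝ) : Matrix ι ι ℝ :=
  (g p)⁻¹ * (Om p)ᵀ

/-- The trace `⟨Φ, Om⟩ = (1/2) Φ_ab Om_cd g^ac g^bd` of a 2-form `Φ` with respect to `Om`. -/
def traceForm (g Om Φ : (ι → ℝ) → Matrix ι ι ℝ) (p : ι → ℝ) : ℝ :=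
  (1 / 2) * ∑ a, ∑ b, ∑ c, ∑ d, Φ p a b * Om p c d * (g p)⁻¹ a c * (g p)⁻¹ b d

/-- `Φ` is a nontrivial Hamiltonian 2-form on the open set `D` for the Kähler structure `(g, Om)`:
a smooth real `J`-invariant 2-form, not a constant multiple of `Om`, such that for all `X`
`∇_X Φ = (1/2) (dσ ∧ (JX)♭ - J dσ ∧ X♭)`, where `σ = ⟨Φ, Om⟩` and `(Jα)(Y) = -α(JY)`. -/
structure IsHamiltonianTwoForm (D : Set (ι → ℝ)) (g Om Φ : (ι → ℝ) → Matrix ι ι ℝ) : Prop where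
  smooth : ∀ i j, ContDiffOn ℝ ∞ (fun p => Φ p i j) D
  skew : ∀ p ∈ D, (Φ p)ᵀ = -Φ p
  invariant : ∀ p ∈ D,
    (complexStructure g Om p)ᵀ * Φ p * complexStructure g Om p = Φ p
  eqn : ∀ p ∈ D, ∀ k i j : ι,
    covDeriv g Φ p k i j = (1 / 2) *
      (partialDeriv i (traceForm g Om Φ) p * Om p k j
        - partialDeriv j (traceForm g Om Φ) p * Om p k i
        + (∑ c, partialDeriv c (traceForm g Om Φ) p * complexStructure g Om p c i) * g p k j
        - (∑ c, partialDeriv c (traceForm g Om Φ) p * complexStructure g Om p c j) * g p k i)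
  nontrivial : ¬ ∃ c : ℝ, ∀ p ∈ D, Φ p = c • Om p

end Chart

/-! ### Labelled quadrilaterals

`𝔱* = 𝔱 = ℝ²`, paired by the dot product. A quadrilateral is given by its vertices
`s 0, s 1, s 2, s 3` in cyclic order; its `i`-th edge joins `s i` to `s (i + 1)`. -/

/-- `n` is an inward normal to the `i`-th edge of the quadrilateral with vertices `s`. -/
def IsInwardNormal (s : Fin 4 → Fin 2 → ℝ) (i : Fin 4) (n : Fin 2 → ℝ) : Prop :=
  n ⬝ᵥ (s (i + 1) - s i) = 0 ∧ ∀ j, j ≠ i → j ≠ i + 1 → 0 < n ⬝ᵥ (s j - s i)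

/-- `s` lists the vertices of a convex quadrilateral in cyclic order: for every edge, the two
remaining vertices lie strictly on the same side of its line. -/
def IsConvexQuadrilateral (s : Fin 4 → Fin 2 → ℝ) : Prop :=
  ∀ i, ∃ n, IsInwardNormal s i n

/-- The quadrilateral with vertices `s`. -/
def polytope (s : Fin 4 → Fin 2 → ℝ) : Set (Fin 2 → ℝ) :=
  convexHull ℝ (Set.range s)

/-- `u` is a labelling: a choice of an inward normal to every edge. -/
def IsLabelling (s u : Fin 4 → Fin 2 → ℝ) : Prop :=
  ∀ i, IsInwardNormal s i (u i)

/-- The linear function `⟨·, a⟩` is equipoised on the quadrilateral with vertices `s`. -/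
def IsEquipoised (s : Fin 4 → Fin 2 → ℝ) (a : Fin 2 → ℝ) : Prop :=
  ∑ i : Fin 4, (-1 : ℝ) ^ (i : ℕ) * (a ⬝ᵥ s i) = 0

/-- The defining function `Lᵢ` of the `i`-th edge: `dLᵢ = uᵢ` and `Lᵢ = 0` on the edge. -/
def definingFunction (s u : Fin 4 → Fin 2 → ℝ) (i : Fin 4) (p : Fin 2 → ℝ) : ℝ :=
  u i ⬝ᵥ (p - s i)

/-- The labelled quadrilateral is monotone. -/
def IsMonotone (s u : Fin 4 → Fin 2 → ℝ) : Prop :=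
  ∃ p ∈ polytope s, ∀ i j, definingFunction s u i p = definingFunction s u j p

/-- `C` is a `d`-dimensional cone of labellings. With respect to some (equivalently, any) reference
labelling `ν`, every labelling is `uᵢ = wᵢ⁻¹ νᵢ` for unique `wᵢ > 0`, and `C` consists of the `u`
for which `w` lies in the intersection, assumed nonempty, of the open positive orthant with a
`d`-dimensional linear subspace of `ℝ⁴`. Such a set is invariant under `u ↦ r u` for `r > 0`. -/
def IsLabelCone (s : Fin 4 → Fin 2 → ℝ) (d : ℕ) (C : Set (Fin 4 → Fin 2 → ℝ)) : Prop :=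
  ∃ ν, IsLabelling s ν ∧ ∃ W : Submodule ℝ (Fin 4 → ℝ), Module.finrank ℝ W = d ∧
    C.Nonempty ∧ C = {u | ∃ w ∈ W, (∀ i, 0 < w i) ∧ ∀ i, u i = (w i)⁻¹ • ν i}

/-! ### Toric Kähler metrics and generalized Kähler–Ricci solitons -/

/-- `φ` is a symplectic potential of the labelled quadrilateral `(s, u)`, and `H` is the inverse of
its Hessian, extended smoothly to the closed quadrilateral. -/
structure IsSymplecticPotential (s u : Fin 4 → Fin 2 → ℝ) (φ : (Fin 2 → ℝ) → ℝ)
    (H : (Fin 2 → ℝ) → Matrix (Fin 2) (Fin 2) ℝ) : Prop where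
  smooth : ContDiffOn ℝ ∞ φ (interior (polytope s))
  convex : ∀ y ∈ interior (polytope s), (hess φ y).PosDef
  inverse : ∀ y ∈ interior (polytope s), H y = (hess φ y)⁻¹
  smooth_ext : ∃ U : Set (Fin 2 → ℝ), IsOpen U ∧ polytope s ⊆ U ∧
    ∀ i j, ContDiffOn ℝ ∞ (fun y => H y i j) U
  boundary : ∀ i, ∀ y ∈ openSegment ℝ (s i) (s (i + 1)), H y *ᵥ u i = 0
  boundary_deriv : ∀ i, ∀ y ∈ openSegment ℝ (s i) (s (i + 1)), ∀ v : Fin 2 → ℝ,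
    fderiv ℝ (fun z => u i ⬝ᵥ (H z *ᵥ u i)) y v = 2 * (u i ⬝ᵥ v)
  positive_edge : ∀ i, ∀ y ∈ openSegment ℝ (s i) (s (i + 1)), ∀ v : Fin 2 → ℝ,
    v ∉ Submodule.span ℝ {u i} → 0 < v ⬝ᵥ (H y *ᵥ v)

/-- The scalar curvature `S(H) = -∑ᵢⱼ ∂²Hᵢⱼ/∂μᵢ∂μⱼ`, as a function on the polytope. -/
def scalarCurvature (H : (Fin 2 → ℝ) → Matrix (Fin 2) (Fin 2) ℝ) (y : Fin 2 → ℝ) : ℝ :=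
  -∑ i, ∑ j, partialDeriv i (partialDeriv j fun z => H z i j) y

/-- The divergence of the vector field `H(a, ·)`, that is, minus the Laplacian of `⟨μ, a⟩`. -/
def divContract (H : (Fin 2 → ℝ) → Matrix (Fin 2) (Fin 2) ℝ) (a y : Fin 2 → ℝ) : ℝ :=
  ∑ i, partialDeriv i (fun z => (H z *ᵥ a) i) y

/-- The equation `Scal - avg(Scal) = 2 Δ⟨μ, a⟩` of a generalized Kähler–Ricci soliton, on the
interior of the polytope. -/
def IsGeneralizedSoliton (s : Fin 4 → Fin 2 → ℝ)
    (H : (Fin 2 → ℝ) → Matrix (Fin 2) (Fin 2) ℝ) (a : Fin 2 → ℝ) : Prop :=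
  ∀ y ∈ interior (polytope s),
    scalarCurvature H y - (⨍ z in polytope s, scalarCurvature H z) = 2 * -divContract H a y

/-- The domain `int(Δ) × ℝ²` of the action-angle coordinates `(μ, t)`; `Sum.inl` indexes `μ` and
`Sum.inr` indexes `t`. -/
def actionAngleDomain (s : Fin 4 → Fin 2 → ℝ) : Set (Fin 2 ⊕ Fin 2 → ℝ) :=
  {p | (fun i => p (Sum.inl i)) ∈ interior (polytope s)}

/-- The toric metric `g = ∑ Gᵢⱼ dμᵢ dμⱼ + Hᵢⱼ dtᵢ dtⱼ` with `G = Hess φ`. -/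
def toricMetric (φ : (Fin 2 → ℝ) → ℝ) (H : (Fin 2 → ℝ) → Matrix (Fin 2) (Fin 2) ℝ)
    (p : Fin 2 ⊕ Fin 2 → ℝ) : Matrix (Fin 2 ⊕ Fin 2) (Fin 2 ⊕ Fin 2) ℝ :=
  Matrix.fromBlocks (hess φ fun i => p (Sum.inl i)) 0 0 (H fun i => p (Sum.inl i))

/-- The symplectic form `ω = ∑ dμᵢ ∧ dtᵢ`. -/
def toricForm (_ : Fin 2 ⊕ Fin 2 → ℝ) : Matrix (Fin 2 ⊕ Fin 2) (Fin 2 ⊕ Fin 2) ℝ :=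
  Matrix.fromBlocks 0 1 (-1) 0

/-- The labelled quadrilateral `(s, u)` admits a generalized Kähler–Ricci soliton `(g, a)` for which
`g` has a nontrivial torus-invariant Hamiltonian 2-form. -/
def AdmitsSolitonWithHamiltonianTwoForm (s u : Fin 4 → Fin 2 → ℝ) (a : Fin 2 → ℝ) : Prop :=
  ∃ φ H, IsSymplecticPotential s u φ H ∧ IsGeneralizedSoliton s H a ∧
    ∃ Φ, IsHamiltonianTwoForm (actionAngleDomain s) (toricMetric φ H) toricForm Φ ∧
      ∀ p q : Fin 2 ⊕ Fin 2 → ℝ, (∀ i, p (Sum.inl i) = q (Sum.inl i)) → Φ p = Φ q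

end ToricKR

end

/-!
# Solitons with Hamiltonian 2-forms on convex quadrilaterals

Every convex quadrilateral is the image of the unit square under a bilinear map
`μ(x, y) = p + x q + y r + x y k`. The images of the lines of constant `x` and of constant `y` are
lines, the Jacobian is an affine function `d₀ + d₁ x + d₂ y`, and a linear function `a` is
equipoised exactly when `⟨k, a⟩ = 0`, that is, when it separates as a function of `x` plus a
function of `y`. This treats parallelograms, trapezoids and generic quadrilaterals (the product,
Calabi and orthotoric cases) at once.

With `v = ∂μ/∂x` and `w = ∂μ/∂y`, the metrics considered have inverse
`H = (A(x) v ⊗ v + B(y) w ⊗ w) / jac`.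

* They are Hessian metrics (`BilinearChart.exists_potential`): `jac dx` depends on `x` only and
  `jac dy` on `y` only, so the gradient of the potential is a sum of primitives of one variable.
* The 2-form with eigenvalues `d₁ x` and `-(d₀ + d₂ y)` on the two coordinate planes is Hamiltonian,
  for any `A` and `B` (`BilinearChart.isHamiltonianTwoForm`). It is not a multiple of the
  symplectic form because the eigenvalues differ by the Jacobian.
* The soliton equation separates into `A'' - 2 ⟨q, a⟩ A' = ℓ₁(x)` and `B'' - 2 ⟨r, a⟩ B' = ℓ₂(y)`
  with `ℓ₁` and `ℓ₂` affine and `ℓ₁ + ℓ₂` a multiple of the Jacobian. With `A` and `B` vanishing at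
  the end points, the solutions form a vector space of dimension two, and the inverse weights
  of the labelling are the values `± A' / 2`, `± B' / 2` at the end points. Integrating once gives
  `A' - 2 ⟨q, a⟩ A = 2 Q` with `Q` quadratic; if the weights are positive then `Q` changes sign once
  and `A` is positive (`profile_pos`). So every labelling in the cone carries a soliton.
* The values of the four defining functions at a point satisfy one linear relation, which cuts the
  plane of solutions in a line (`BilinearChart.exists_smul_of_relation`). The line meets the
  positive orthant: it contains the vector of the values of the defining functions at the barycentre
  of the quadrilateral for the weight `exp (-2 ⟨μ, a⟩)`, an interior point
  (`BilinearChart.weights_monotoneParam_pos`).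
-/

noncomputable section
open Set Filter Topology

namespace ToricKR

/-! ### Bilinear charts of quadrilaterals -/

/-- The oriented area of the parallelogram spanned by `a` and `b`. -/
def cross (a b : Fin 2 → ℝ) : ℝ := a 0 * b 1 - a 1 * b 0

/-- A bilinear chart `(x, y) ↦ p + x q + y r + x y k` of the plane. Its Jacobian determinant is an
affine function of `(x, y)`; the scale `ε` is chosen so that `ε` times the determinant is positive
at the corners of the unit square, hence on the whole square. -/
structure BilinearChart where
  /-- The image of the origin. -/
  p : Fin 2 → ℝ
  /-- The coefficient of `x`. -/
  q : Fin 2 → ℝ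
  /-- The coefficient of `y`. -/
  r : Fin 2 → ℝ
  /-- The coefficient of `x y`. -/
  k : Fin 2 → ℝ
  /-- The scale, which also carries the orientation. -/
  ε : ℝ
  pos00 : 0 < ε * cross q r
  pos10 : 0 < ε * cross q r + ε * cross q k
  pos01 : 0 < ε * cross q r + ε * cross k r
  pos11 : 0 < ε * cross q r + ε * cross q k + ε * cross k r

namespace BilinearChart

variable (c : BilinearChart)

/-- The value of the scaled Jacobian at the origin. -/
def d₀ : ℝ := c.ε * cross c.q c.r
/-- The `x`-derivative of the scaled Jacobian. -/
def d₁ : ℝ := c.ε * cross c.q c.k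
/-- The `y`-derivative of the scaled Jacobian. -/
def d₂ : ℝ := c.ε * cross c.k c.r

/-- The scaled Jacobian determinant of the chart. -/
def jac (x y : ℝ) : ℝ := c.d₀ + c.d₁ * x + c.d₂ * y

/-- The coordinate vector field `∂μ/∂x`. -/
def v (y : ℝ) : Fin 2 → ℝ := c.q + y • c.k
/-- The coordinate vector field `∂μ/∂y`. -/
def w (x : ℝ) : Fin 2 → ℝ := c.r + x • c.k

/-- A conormal to the line of constant `x`; it equals `jac • dx`. -/
def nX (x : ℝ) : Fin 2 → ℝ := ![c.ε * c.w x 1, -(c.ε * c.w x 0)]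
/-- A conormal to the line of constant `y`; it equals `jac • dy`. -/
def nY (y : ℝ) : Fin 2 → ℝ := ![-(c.ε * c.v y 1), c.ε * c.v y 0]

/-- The chart map. -/
def map (z : Fin 2 → ℝ) : Fin 2 → ℝ := c.p + z 0 • c.q + z 1 • c.r + (z 0 * z 1) • c.k

/-- The half-plane (or plane) on which the chart is a diffeomorphism onto its image. -/
def domain : Set (Fin 2 → ℝ) := {z | 0 < c.jac (z 0) (z 1)}

/-- The image of the chart. -/
def image : Set (Fin 2 → ℝ) := c.map '' c.domain

/-- The inverse of the chart on its image. -/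
def coord : (Fin 2 → ℝ) → (Fin 2 → ℝ) := Function.invFunOn c.map c.domain

/-- The coordinate function `x` on the image of the chart. -/
def X (m : Fin 2 → ℝ) : ℝ := c.coord m 0
/-- The coordinate function `y` on the image of the chart. -/
def Y (m : Fin 2 → ℝ) : ℝ := c.coord m 1

lemma nX_dot_v (x y : ℝ) : c.nX x ⬝ᵥ c.v y = c.jac x y := by
  simp [nX, v, w, jac, d₀, d₁, d₂, cross, dotProduct, Fin.sum_univ_two]; ring

lemma nX_dot_w (x : ℝ) : c.nX x ⬝ᵥ c.w x = 0 := by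
  simp [nX, w, dotProduct, Fin.sum_univ_two]; ring

lemma nY_dot_w (x y : ℝ) : c.nY y ⬝ᵥ c.w x = c.jac x y := by
  simp [nY, v, w, jac, d₀, d₁, d₂, cross, dotProduct, Fin.sum_univ_two]; ring

lemma nY_dot_v (y : ℝ) : c.nY y ⬝ᵥ c.v y = 0 := by
  simp [nY, v, dotProduct, Fin.sum_univ_two]; ring

lemma jac_pos {x y : ℝ} (hx : x ∈ Icc (0 : ℝ) 1) (hy : y ∈ Icc (0 : ℝ) 1) : 0 < c.jac x y := by
  have h0 := c.pos00
  have h1 := c.pos10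
  have h2 := c.pos01
  have h3 := c.pos11
  obtain ⟨x0, x1⟩ := hx
  obtain ⟨y0, y1⟩ := hy
  have e : c.jac x y = (c.d₀ * (1 - x) + (c.d₀ + c.d₁) * x) * (1 - y)
      + ((c.d₀ + c.d₂) * (1 - x) + (c.d₀ + c.d₁ + c.d₂) * x) * y := by simp only [jac]; ring
  have pos : ∀ a b t : ℝ, 0 < a → 0 < b → 0 ≤ t → t ≤ 1 → 0 < a * (1 - t) + b * t := by
    intro a b t ha hb h0 h1
    rcases h0.eq_or_lt with rfl | h0
    · simpa using ha
    · nlinarith [mul_pos hb h0, mul_nonneg ha.le (sub_nonneg.2 h1)]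
  rw [e]
  exact pos _ _ y (pos _ _ x h0 h1 x0 x1) (pos _ _ x h2 h3 x0 x1) y0 y1

lemma ε_ne_zero : c.ε ≠ 0 := by
  intro h
  have := c.pos00
  simp [h] at this

/-- The difference of two values of the chart is controlled by the frame at the midpoint, because
the chart is of degree one in each variable. -/
lemma map_sub_map (z z' : Fin 2 → ℝ) : c.map z - c.map z' =
    (z 0 - z' 0) • c.v ((z 1 + z' 1) / 2) + (z 1 - z' 1) • c.w ((z 0 + z' 0) / 2) := by
  ext i
  simp [map, v, w]
  ring

lemma injOn_map : InjOn c.map c.domain := by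
  intro z hz z' hz' h
  have hm : 0 < c.jac ((z 0 + z' 0) / 2) ((z 1 + z' 1) / 2) := by
    simp only [domain, jac, mem_ofPred_eq] at *
    linarith
  have e := c.map_sub_map z z'
  rw [h, sub_self] at e
  have e0 := congrArg (c.nX ((z 0 + z' 0) / 2) ⬝ᵥ ·) e
  have e1 := congrArg (c.nY ((z 1 + z' 1) / 2) ⬝ᵥ ·) e
  simp only [dotProduct_zero, dotProduct_add, dotProduct_smul, nX_dot_v, nX_dot_w, nY_dot_v,
    nY_dot_w, smul_eq_mul, mul_zero, add_zero, zero_add, zero_eq_mul, hm.ne', or_false] at e0 e1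
  ext i
  fin_cases i
  · exact sub_eq_zero.1 e0
  · exact sub_eq_zero.1 e1

lemma isOpen_domain : IsOpen c.domain :=
  isOpen_lt continuous_const (by unfold jac; fun_prop)

lemma contDiff_map : ContDiff ℝ ∞ c.map := by
  unfold map
  fun_prop

lemma coord_map {z : Fin 2 → ℝ} (hz : z ∈ c.domain) : c.coord (c.map z) = z :=
  c.injOn_map.leftInvOn_invFunOn hz

lemma map_coord {m : Fin 2 → ℝ} (hm : m ∈ c.image) : c.map (c.coord m) = m :=
  Function.invFunOn_eq hm

lemma coord_mem {m : Fin 2 → ℝ} (hm : m ∈ c.image) : c.coord m ∈ c.domain :=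
  Function.invFunOn_mem hm

lemma jac_coord_pos {m : Fin 2 → ℝ} (hm : m ∈ c.image) : 0 < c.jac (c.X m) (c.Y m) :=
  c.coord_mem hm

/-- Every vector is a combination of `∂μ/∂x` and `∂μ/∂y`, with coefficients its pairings with
`dx` and `dy`. -/
lemma frame_expand {x y : ℝ} (h : c.jac x y ≠ 0) (m : Fin 2 → ℝ) :
    (c.nX x ⬝ᵥ m / c.jac x y) • c.v y + (c.nY y ⬝ᵥ m / c.jac x y) • c.w x = m := by
  ext i
  simp only [Pi.add_apply, Pi.smul_apply, smul_eq_mul]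
  field_simp
  fin_cases i <;>
  · simp [nX, nY, v, w, jac, d₀, d₁, d₂, cross, dotProduct, Fin.sum_univ_two]
    ring

/-- The differential of the chart at `z`, an isomorphism. -/
def derivEquiv (z : Fin 2 → ℝ) (h : c.jac (z 0) (z 1) ≠ 0) : (Fin 2 → ℝ) ≃L[ℝ] (Fin 2 → ℝ) :=
  LinearEquiv.toContinuousLinearEquiv
    { toFun := fun m => m 0 • c.v (z 1) + m 1 • c.w (z 0)
      map_add' := fun m n => by ext i; simp; ring
      map_smul' := fun t m => by ext i; simp; ring
      invFun := fun m => ![c.nX (z 0) ⬝ᵥ m / c.jac (z 0) (z 1), c.nY (z 1) ⬝ᵥ m / c.jac (z 0) (z 1)]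
      left_inv := fun m => by
        simp only [dotProduct_add, dotProduct_smul, nX_dot_v, nX_dot_w, nY_dot_v, nY_dot_w,
          smul_eq_mul, mul_zero, add_zero, zero_add, mul_div_cancel_right₀ _ h]
        ext i
        fin_cases i <;> rfl
      right_inv := fun m => by simpa using c.frame_expand h m }

lemma derivEquiv_apply (z : Fin 2 → ℝ) (h : c.jac (z 0) (z 1) ≠ 0) (m : Fin 2 → ℝ) :
    c.derivEquiv z h m = m 0 • c.v (z 1) + m 1 • c.w (z 0) := rfl

lemma derivEquiv_symm_apply (z : Fin 2 → ℝ) (h : c.jac (z 0) (z 1) ≠ 0) (m : Fin 2 → ℝ) :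
    (c.derivEquiv z h).symm m =
      ![c.nX (z 0) ⬝ᵥ m / c.jac (z 0) (z 1), c.nY (z 1) ⬝ᵥ m / c.jac (z 0) (z 1)] := rfl

lemma hasStrictFDerivAt_map (z : Fin 2 → ℝ) (h : c.jac (z 0) (z 1) ≠ 0) :
    HasStrictFDerivAt c.map (c.derivEquiv z h : (Fin 2 → ℝ) →L[ℝ] (Fin 2 → ℝ)) z := by
  refine c.contDiff_map.contDiffAt.hasStrictFDerivAt' ?_ (by simp)
  rw [hasFDerivAt_pi']
  intro i
  have h0 : HasFDerivAt (fun z : Fin 2 → ℝ => z 0) (ContinuousLinearMap.proj 0) z :=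
    (ContinuousLinearMap.proj (R := ℝ) (φ := fun _ : Fin 2 => ℝ) 0).hasFDerivAt
  have h1 : HasFDerivAt (fun z : Fin 2 → ℝ => z 1) (ContinuousLinearMap.proj 1) z :=
    (ContinuousLinearMap.proj (R := ℝ) (φ := fun _ : Fin 2 => ℝ) 1).hasFDerivAt
  have := (((hasFDerivAt_const (c.p i) z).add (h0.mul_const (c.q i))).add
    (h1.mul_const (c.r i))).add ((h0.mul h1).mul_const (c.k i))
  convert! this using 1
  ext m
  simp [derivEquiv_apply, v, w]
  ring

lemma isOpen_image : IsOpen c.image := by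
  rw [isOpen_iff_mem_nhds]
  rintro _ ⟨z, hz, rfl⟩
  have := (c.hasStrictFDerivAt_map z hz.ne').map_nhds_eq_of_equiv
  rw [← this]
  exact image_mem_map (c.isOpen_domain.mem_nhds hz)

lemma eventually_coord_map {z : Fin 2 → ℝ} (hz : z ∈ c.domain) :
    ∀ᶠ x in 𝓝 z, c.coord (c.map x) = x := by
  filter_upwards [c.isOpen_domain.mem_nhds hz] with x hx using c.coord_map hx

lemma hasFDerivAt_coord {z : Fin 2 → ℝ} (hz : z ∈ c.domain) :
    HasFDerivAt c.coord ((c.derivEquiv z hz.ne').symm : (Fin 2 → ℝ) →L[ℝ] (Fin 2 → ℝ)) (c.map z) :=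
  ((c.hasStrictFDerivAt_map z hz.ne').to_local_left_inverse (c.eventually_coord_map hz)).hasFDerivAt

lemma contDiffOn_coord : ContDiffOn ℝ ∞ c.coord c.image := by
  rintro _ ⟨z, hz, rfl⟩
  have hs := c.hasStrictFDerivAt_map z hz.ne'
  have h1 := (c.contDiff_map.contDiffAt (x := z)).to_localInverse hs.hasFDerivAt (by simp)
  have h2 := hs.localInverse_unique (c.eventually_coord_map hz)
  exact (h1.congr_of_eventuallyEq h2).contDiffWithinAt

lemma contDiffOn_X : ContDiffOn ℝ ∞ c.X c.image :=
  (contDiff_apply ℝ ℝ (0 : Fin 2)).comp_contDiffOn c.contDiffOn_coord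

lemma contDiffOn_Y : ContDiffOn ℝ ∞ c.Y c.image :=
  (contDiff_apply ℝ ℝ (1 : Fin 2)).comp_contDiffOn c.contDiffOn_coord

/-! ### Differential calculus in the chart coordinates -/

/-- The components of the differential `dx`. -/
def dx (m : Fin 2 → ℝ) : Fin 2 → ℝ := fun i => c.nX (c.X m) i / c.jac (c.X m) (c.Y m)
/-- The components of the differential `dy`. -/
def dy (m : Fin 2 → ℝ) : Fin 2 → ℝ := fun i => c.nY (c.Y m) i / c.jac (c.X m) (c.Y m)

/-- Pairing with a covector, as a continuous linear map. -/
def pairing (a : Fin 2 → ℝ) : (Fin 2 → ℝ) →L[ℝ] ℝ :=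
  LinearMap.toContinuousLinearMap (dotProductBilin ℝ ℝ a)

/-- `f` is differentiable at `m` with differential `a dx + b dy`. -/
def HasPartials (f : (Fin 2 → ℝ) → ℝ) (a b : ℝ) (m : Fin 2 → ℝ) : Prop :=
  HasFDerivAt f (pairing (a • c.dx m + b • c.dy m)) m

variable {c}

lemma pairing_apply (a m : Fin 2 → ℝ) : pairing a m = a ⬝ᵥ m := rfl

lemma HasPartials.partialDeriv {f : (Fin 2 → ℝ) → ℝ} {a b : ℝ} {m : Fin 2 → ℝ}
    (h : c.HasPartials f a b m) (i : Fin 2) :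
    partialDeriv i f m = a * c.dx m i + b * c.dy m i := by
  rw [ToricKR.partialDeriv, HasFDerivAt.fderiv h, pairing_apply, dotProduct_single]
  simp

lemma HasPartials.congr {f : (Fin 2 → ℝ) → ℝ} {a b a' b' : ℝ} {m : Fin 2 → ℝ}
    (h : c.HasPartials f a b m) (ha : a = a') (hb : b = b') : c.HasPartials f a' b' m :=
  ha ▸ hb ▸ h

lemma hasPartials_const (t : ℝ) (m : Fin 2 → ℝ) : c.HasPartials (fun _ => t) 0 0 m := by
  refine (hasFDerivAt_const t m).congr_fderiv ?_
  ext n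
  simp [pairing_apply]

lemma HasPartials.add {f g : (Fin 2 → ℝ) → ℝ} {a b a' b' : ℝ} {m : Fin 2 → ℝ}
    (hf : c.HasPartials f a b m) (hg : c.HasPartials g a' b' m) :
    c.HasPartials (fun n => f n + g n) (a + a') (b + b') m := by
  refine (HasFDerivAt.add hf hg).congr_fderiv ?_
  ext n
  simp only [_root_.add_apply, pairing_apply, add_dotProduct, smul_dotProduct,
    smul_eq_mul]
  ring

lemma HasPartials.mul {f g : (Fin 2 → ℝ) → ℝ} {a b a' b' : ℝ} {m : Fin 2 → ℝ}
    (hf : c.HasPartials f a b m) (hg : c.HasPartials g a' b' m) :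
    c.HasPartials (fun n => f n * g n) (a * g m + f m * a') (b * g m + f m * b') m := by
  refine (HasFDerivAt.mul hf hg).congr_fderiv ?_
  ext n
  simp only [_root_.add_apply, _root_.smul_apply, pairing_apply,
    add_dotProduct, smul_dotProduct, smul_eq_mul]
  ring

lemma HasPartials.comp {f : (Fin 2 → ℝ) → ℝ} {a b : ℝ} {m : Fin 2 → ℝ} {h : ℝ → ℝ} {h' : ℝ}
    (hh : HasDerivAt h h' (f m)) (hf : c.HasPartials f a b m) :
    c.HasPartials (fun n => h (f n)) (h' * a) (h' * b) m := by
  refine (hh.comp_hasFDerivAt m hf).congr_fderiv ?_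
  ext n
  simp only [_root_.smul_apply, pairing_apply,
    add_dotProduct, smul_dotProduct, smul_eq_mul]
  ring

lemma HasPartials.inv {f : (Fin 2 → ℝ) → ℝ} {a b : ℝ} {m : Fin 2 → ℝ}
    (hf : c.HasPartials f a b m) (h0 : f m ≠ 0) :
    c.HasPartials (fun n => (f n)⁻¹) (-a / f m ^ 2) (-b / f m ^ 2) m :=
  (HasPartials.comp (hasDerivAt_inv h0) hf).congr (by ring) (by ring)

lemma HasPartials.div {f g : (Fin 2 → ℝ) → ℝ} {a b a' b' : ℝ} {m : Fin 2 → ℝ}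
    (hf : c.HasPartials f a b m) (hg : c.HasPartials g a' b' m) (h0 : g m ≠ 0) :
    c.HasPartials (fun n => f n / g n) ((a - f m / g m * a') / g m)
      ((b - f m / g m * b') / g m) m := by
  have := hf.mul (hg.inv h0)
  simp only [← div_eq_mul_inv] at this
  refine this.congr ?_ ?_ <;> field_simp <;> ring

lemma HasPartials.congr_of_eventuallyEq {f g : (Fin 2 → ℝ) → ℝ} {a b : ℝ} {m : Fin 2 → ℝ}
    (hf : c.HasPartials f a b m) (h : g =ᶠ[𝓝 m] f) : c.HasPartials g a b m :=
  HasFDerivAt.congr_of_eventuallyEq hf h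

lemma hasPartials_coord {m : Fin 2 → ℝ} (hm : m ∈ c.image) :
    c.HasPartials c.X 1 0 m ∧ c.HasPartials c.Y 0 1 m := by
  have h := c.hasFDerivAt_coord (c.coord_mem hm)
  rw [c.map_coord hm, hasFDerivAt_pi'] at h
  constructor
  · refine (h 0).congr_fderiv ?_
    ext n
    simp [derivEquiv_symm_apply, pairing_apply, dx, X, Y]
    ring
  · refine (h 1).congr_fderiv ?_
    ext n
    simp [derivEquiv_symm_apply, pairing_apply, dy, X, Y]
    ring

lemma hasPartials_X {m : Fin 2 → ℝ} (hm : m ∈ c.image) : c.HasPartials c.X 1 0 m :=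
  (hasPartials_coord hm).1

lemma hasPartials_Y {m : Fin 2 → ℝ} (hm : m ∈ c.image) : c.HasPartials c.Y 0 1 m :=
  (hasPartials_coord hm).2

lemma hasPartials_comp_X {h : ℝ → ℝ} {h' : ℝ} {m : Fin 2 → ℝ} (hm : m ∈ c.image)
    (hh : HasDerivAt h h' (c.X m)) : c.HasPartials (fun n => h (c.X n)) h' 0 m :=
  (HasPartials.comp hh (hasPartials_X hm)).congr (mul_one _) (mul_zero _)

lemma hasPartials_comp_Y {h : ℝ → ℝ} {h' : ℝ} {m : Fin 2 → ℝ} (hm : m ∈ c.image)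
    (hh : HasDerivAt h h' (c.Y m)) : c.HasPartials (fun n => h (c.Y n)) 0 h' m :=
  (HasPartials.comp hh (hasPartials_Y hm)).congr (mul_zero _) (mul_one _)

variable (c)

/-- The frame field `∂μ/∂x` as a function on the image of the chart. -/
def vf (m : Fin 2 → ℝ) : Fin 2 → ℝ := c.v (c.Y m)
/-- The frame field `∂μ/∂y` as a function on the image of the chart. -/
def wf (m : Fin 2 → ℝ) : Fin 2 → ℝ := c.w (c.X m)
/-- The scaled Jacobian as a function on the image of the chart. -/
def jf (m : Fin 2 → ℝ) : ℝ := c.jac (c.X m) (c.Y m)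
/-- The logarithmic `x`-derivative of the Jacobian. -/
def lx (m : Fin 2 → ℝ) : ℝ := c.d₁ / c.jf m
/-- The logarithmic `y`-derivative of the Jacobian. -/
def ly (m : Fin 2 → ℝ) : ℝ := c.d₂ / c.jf m

variable {c}

lemma jf_ne_zero {m : Fin 2 → ℝ} (hm : m ∈ c.image) : c.jf m ≠ 0 := (c.jac_coord_pos hm).ne'

/-- The mixed second derivative `k` of the chart, expanded in the frame `∂μ/∂x`, `∂μ/∂y`. -/
lemma k_eq {m : Fin 2 → ℝ} (hm : m ∈ c.image) (i : Fin 2) :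
    c.k i = c.ly m * c.vf m i + c.lx m * c.wf m i := by
  have := jf_ne_zero hm
  simp only [lx, ly]
  field_simp
  simp only [jf, vf, wf]
  fin_cases i <;>
  · simp [v, w, jac, d₀, d₁, d₂, cross]
    ring

lemma hasPartials_jf {m : Fin 2 → ℝ} (hm : m ∈ c.image) :
    c.HasPartials c.jf (c.lx m * c.jf m) (c.ly m * c.jf m) m := by
  have h := ((hasPartials_const c.d₀ m).add ((hasPartials_const c.d₁ m).mul (hasPartials_X hm))).add
    ((hasPartials_const c.d₂ m).mul (hasPartials_Y hm))
  have := jf_ne_zero hm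
  refine h.congr ?_ ?_ <;> simp [lx, ly, this]

lemma hasPartials_vf {m : Fin 2 → ℝ} (hm : m ∈ c.image) (i : Fin 2) :
    c.HasPartials (fun n => c.vf n i) 0 (c.ly m * c.vf m i + c.lx m * c.wf m i) m := by
  rw [← k_eq hm]
  have h := (hasPartials_const (c.q i) m).add ((hasPartials_Y hm).mul (hasPartials_const (c.k i) m))
  refine h.congr ?_ ?_ <;> simp

lemma hasPartials_wf {m : Fin 2 → ℝ} (hm : m ∈ c.image) (i : Fin 2) :
    c.HasPartials (fun n => c.wf n i) (c.ly m * c.vf m i + c.lx m * c.wf m i) 0 m := by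
  rw [← k_eq hm]
  have h := (hasPartials_const (c.r i) m).add ((hasPartials_X hm).mul (hasPartials_const (c.k i) m))
  refine h.congr ?_ ?_ <;> simp

/-- The second derivatives of the coordinate `x` on the plane, expanded in the coframe. -/
lemma hasPartials_dx {m : Fin 2 → ℝ} (hm : m ∈ c.image) (i : Fin 2) :
    c.HasPartials (fun n => c.dx n i) (-(c.ly m * c.dy m i)) (-(c.ly m * c.dx m i)) m := by
  have hj := jf_ne_zero hm
  have hj' : c.jac (c.X m) (c.Y m) ≠ 0 := hj
  have key : ∃ t, c.HasPartials (fun n => c.nX (c.X n) i) t 0 m ∧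
      t = c.d₁ * c.dx m i - c.d₂ * c.dy m i := by
    fin_cases i
    · refine ⟨_, (((hasPartials_const c.ε m).mul (hasPartials_wf hm 1)).congr rfl ?_), ?_⟩
      · simp
      · rw [← k_eq hm]
        simp only [dx, dy, nX, nY, d₁, d₂, cross]
        field_simp
        simp [v, w, jac, d₀, d₁, d₂, cross]
        ring
    · refine ⟨_, (((hasPartials_const (-c.ε) m).mul
        (hasPartials_wf hm 0)).congr_of_eventuallyEq ?_).congr rfl ?_, ?_⟩
      · exact Eventually.of_forall fun n => by simp [nX, wf]
      · simp
      · rw [← k_eq hm]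
        simp only [dx, dy, nX, nY, d₁, d₂, cross]
        field_simp
        simp [v, w, jac, d₀, d₁, d₂, cross]
        ring
  obtain ⟨t, ht, rfl⟩ := key
  refine (ht.div (hasPartials_jf hm) hj).congr ?_ ?_
  · change (_ - c.dx m i * _) / _ = _
    simp only [lx, ly]
    field_simp
    ring
  · change (_ - c.dx m i * _) / _ = _
    simp only [ly]
    field_simp
    ring

/-- The second derivatives of the coordinate `y` on the plane, expanded in the coframe. -/
lemma hasPartials_dy {m : Fin 2 → ℝ} (hm : m ∈ c.image) (i : Fin 2) :
    c.HasPartials (fun n => c.dy n i) (-(c.lx m * c.dy m i)) (-(c.lx m * c.dx m i)) m := by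
  have hj := jf_ne_zero hm
  have hj' : c.jac (c.X m) (c.Y m) ≠ 0 := hj
  have key : ∃ t, c.HasPartials (fun n => c.nY (c.Y n) i) 0 t m ∧
      t = c.d₂ * c.dy m i - c.d₁ * c.dx m i := by
    fin_cases i
    · refine ⟨_, (((hasPartials_const (-c.ε) m).mul
        (hasPartials_vf hm 1)).congr_of_eventuallyEq ?_).congr ?_ rfl, ?_⟩
      · exact Eventually.of_forall fun n => by simp [nY, vf]
      · simp
      · rw [← k_eq hm]
        simp only [dx, dy, nX, nY, d₁, d₂, cross]
        field_simp
        simp [v, w, jac, d₀, d₁, d₂, cross]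
        ring
    · refine ⟨_, (((hasPartials_const c.ε m).mul (hasPartials_vf hm 0)).congr ?_ rfl), ?_⟩
      · simp
      · rw [← k_eq hm]
        simp only [dx, dy, nX, nY, d₁, d₂, cross]
        field_simp
        simp [v, w, jac, d₀, d₁, d₂, cross]
        ring
  obtain ⟨t, ht, rfl⟩ := key
  refine (ht.div (hasPartials_jf hm) hj).congr ?_ ?_
  · change (_ - c.dy m i * _) / _ = _
    simp only [lx]
    field_simp
    ring
  · change (_ - c.dy m i * _) / _ = _
    simp only [lx, ly]
    field_simp
    ring

end BilinearChart

/-! ### Torus-invariant block tensors in action-angle coordinates -/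

/-- The action coordinates of a point in action-angle coordinates. -/
def action (p : Fin 2 ⊕ Fin 2 → ℝ) : Fin 2 → ℝ := fun i => p (Sum.inl i)

/-- The metric with blocks `G` on the actions and `H` on the angles. -/
def blockMetric (G H : (Fin 2 → ℝ) → Matrix (Fin 2) (Fin 2) ℝ) (p : Fin 2 ⊕ Fin 2 → ℝ) :
    Matrix (Fin 2 ⊕ Fin 2) (Fin 2 ⊕ Fin 2) ℝ :=
  Matrix.fromBlocks (G (action p)) 0 0 (H (action p))

/-- The 2-form `∑ Mᵢⱼ dμᵢ ∧ dtⱼ`. -/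
def blockForm (M : (Fin 2 → ℝ) → Matrix (Fin 2) (Fin 2) ℝ) (p : Fin 2 ⊕ Fin 2 → ℝ) :
    Matrix (Fin 2 ⊕ Fin 2) (Fin 2 ⊕ Fin 2) ℝ :=
  Matrix.fromBlocks 0 (M (action p)) (-(M (action p))ᵀ) 0

/-- The action coordinates as a continuous linear map. -/
def actionCLM : (Fin 2 ⊕ Fin 2 → ℝ) →L[ℝ] (Fin 2 → ℝ) :=
  ContinuousLinearMap.pi fun i => ContinuousLinearMap.proj (Sum.inl i)

lemma partialDeriv_action_inl {f : (Fin 2 → ℝ) → ℝ} {p : Fin 2 ⊕ Fin 2 → ℝ}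
    (hf : DifferentiableAt ℝ f (action p)) (k : Fin 2) :
    partialDeriv (Sum.inl k) (fun q => f (action q)) p = partialDeriv k f (action p) := by
  have h : HasFDerivAt (fun q => f (action q)) _ p :=
    hf.hasFDerivAt.comp (f := action) p actionCLM.hasFDerivAt
  rw [partialDeriv, HasFDerivAt.fderiv h, partialDeriv, ContinuousLinearMap.comp_apply]
  congr 1
  ext i
  simp [actionCLM, Pi.single_apply]

lemma partialDeriv_action_inr {f : (Fin 2 → ℝ) → ℝ} {p : Fin 2 ⊕ Fin 2 → ℝ}
    (hf : DifferentiableAt ℝ f (action p)) (k : Fin 2) :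
    partialDeriv (Sum.inr k) (fun q => f (action q)) p = 0 := by
  have h : HasFDerivAt (fun q => f (action q)) _ p :=
    hf.hasFDerivAt.comp (f := action) p actionCLM.hasFDerivAt
  rw [partialDeriv, HasFDerivAt.fderiv h, ContinuousLinearMap.comp_apply]
  have : actionCLM (Pi.single (Sum.inr k) 1) = 0 := by
    ext i
    simp [actionCLM]
  rw [this, map_zero]

lemma partialDeriv_const {ι : Type*} [Fintype ι] [DecidableEq ι] (i : ι) (t : ℝ) (p : ι → ℝ) :
    partialDeriv i (fun _ => t) p = 0 := by
  simp [partialDeriv]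

section

variable {G H M : (Fin 2 → ℝ) → Matrix (Fin 2) (Fin 2) ℝ}

lemma inv_blockMetric {p : Fin 2 ⊕ Fin 2 → ℝ} (h : G (action p) * H (action p) = 1) :
    (blockMetric G H p)⁻¹ = Matrix.fromBlocks (H (action p)) 0 0 (G (action p)) := by
  refine Matrix.inv_eq_right_inv ?_
  simp [blockMetric, Matrix.fromBlocks_multiply, h, mul_eq_one_comm.1 h]

lemma complexStructure_block {p : Fin 2 ⊕ Fin 2 → ℝ} (h : G (action p) * H (action p) = 1) :
    complexStructure (blockMetric G H) toricForm p =
      Matrix.fromBlocks 0 (-H (action p)) (G (action p)) 0 := by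
  rw [complexStructure, inv_blockMetric h, toricForm]
  simp [Matrix.fromBlocks_transpose, Matrix.fromBlocks_multiply]

lemma traceForm_block {p : Fin 2 ⊕ Fin 2 → ℝ} (h : G (action p) * H (action p) = 1)
    (hG : (G (action p))ᵀ = G (action p)) :
    traceForm (blockMetric G H) toricForm (blockForm M) p = (M (action p)).trace := by
  rw [traceForm, inv_blockMetric h]
  have h' := mul_eq_one_comm.1 h
  have e00 := congrFun (congrFun h' 0) 0
  have e01 := congrFun (congrFun h' 0) 1
  have e10 := congrFun (congrFun h' 1) 0
  have e11 := congrFun (congrFun h' 1) 1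
  have s := congrFun (congrFun hG 0) 1
  simp only [Matrix.mul_apply, Fin.sum_univ_two, Matrix.transpose_apply, Matrix.one_apply] at *
  simp [Fintype.sum_sum_type, toricForm, blockForm, Fin.sum_univ_two,
    Matrix.trace]
  simp at e00 e01 e10 e11
  rw [s] at e00 e10 ⊢
  linear_combination M (action p) 0 0 * e00 + M (action p) 0 1 * e01 + M (action p) 1 0 * e10
    + M (action p) 1 1 * e11

/-- The 2-form `∑ Mᵢⱼ dμᵢ ∧ dtⱼ` is a Hamiltonian 2-form for the metric with blocks `G` and
`H = G⁻¹` as soon as `M` satisfies the equation on the plane of the actions: the components of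
type `(μ, μ, t)`, `(t, μ, μ)` and `(t, t, t)` of the equation are the only ones that do not vanish
identically. -/
theorem isHamiltonianTwoForm_block {O : Set (Fin 2 → ℝ)} (hO : IsOpen O)
    (hG : ∀ m ∈ O, ∀ i j, DifferentiableAt ℝ (fun n => G n i j) m)
    (hH : ∀ m ∈ O, ∀ i j, DifferentiableAt ℝ (fun n => H n i j) m)
    (hM : ∀ i j, ContDiffOn ℝ ∞ (fun n => M n i j) O)
    (hGH : ∀ m ∈ O, G m * H m = 1)
    (sG : ∀ m ∈ O, (G m)ᵀ = G m) (sH : ∀ m ∈ O, (H m)ᵀ = H m)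
    (hinv : ∀ m ∈ O, H m * M m * G m = (M m)ᵀ)
    (hnt : ∀ t : ℝ, ∃ m ∈ O, M m ≠ t • (1 : Matrix (Fin 2) (Fin 2) ℝ))
    (e₁ : ∀ m ∈ O, ∀ k i j, partialDeriv k (fun n => M n i j) m
      - ∑ l, ((1 / 2) * ∑ n, H m l n * (partialDeriv k (fun q => G q i n) m
        + partialDeriv i (fun q => G q k n) m - partialDeriv n (fun q => G q k i) m)) * M m l j
      - ∑ l, ((1 / 2) * ∑ n, G m l n * partialDeriv k (fun q => H q j n) m) * M m i l
      = (1 / 2) * (partialDeriv i (fun n => (M n).trace) m * (1 : Matrix (Fin 2) (Fin 2) ℝ) k j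
        + (∑ n, partialDeriv n (fun n => (M n).trace) m * H m n j) * G m k i))
    (e₂ : ∀ m ∈ O, ∀ k i j, ∑ l, ((1 / 2) * ∑ n, G m l n * partialDeriv i (fun q => H q k n) m)
        * M m j l - ∑ l, ((1 / 2) * ∑ n, G m l n * partialDeriv j (fun q => H q k n) m) * M m i l
      = (1 / 2) * (-(partialDeriv i (fun n => (M n).trace) m * (1 : Matrix (Fin 2) (Fin 2) ℝ) k j)
        + partialDeriv j (fun n => (M n).trace) m * (1 : Matrix (Fin 2) (Fin 2) ℝ) k i))
    (e₃ : ∀ m ∈ O, ∀ k i j, ∑ l, ((1 / 2) * ∑ n, H m l n * partialDeriv n (fun q => H q k i) m)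
        * M m l j - ∑ l, ((1 / 2) * ∑ n, H m l n * partialDeriv n (fun q => H q k j) m) * M m l i
      = (1 / 2) * (-(∑ n, partialDeriv n (fun n => (M n).trace) m * H m n i) * H m k j
        + (∑ n, partialDeriv n (fun n => (M n).trace) m * H m n j) * H m k i)) :
    IsHamiltonianTwoForm {p | action p ∈ O} (blockMetric G H) toricForm (blockForm M) := by
  have cont : Continuous action := actionCLM.continuous
  have hopen : IsOpen {p | action p ∈ O} := hO.preimage cont
  have hM' : ∀ m ∈ O, ∀ i j, DifferentiableAt ℝ (fun n => M n i j) m := fun m hm i j =>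
    ((hM i j).contDiffAt (hO.mem_nhds hm)).differentiableAt (by simp)
  have hT : ∀ m ∈ O, DifferentiableAt ℝ (fun n => (M n).trace) m := by
    intro m hm
    simp only [Matrix.trace, Matrix.diag, Fin.sum_univ_two]
    exact (hM' m hm 0 0).add (hM' m hm 1 1)
  refine ⟨?_, ?_, ?_, ?_, ?_⟩
  · have hact : ContDiffOn ℝ ∞ action {p | action p ∈ O} := actionCLM.contDiff.contDiffOn
    have hb : ∀ i j, ContDiffOn ℝ ∞ (fun p => M (action p) i j) {p | action p ∈ O} :=
      fun i j => (hM i j).comp hact fun _ h => h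
    rintro (i | i) (j | j)
    · exact contDiffOn_const
    · exact hb i j
    · exact (hb j i).neg
    · exact contDiffOn_const
  · intro p _
    simp [blockForm, Matrix.fromBlocks_transpose, Matrix.fromBlocks_neg]
  · intro p hp
    rw [complexStructure_block (hGH _ hp)]
    have h1 := hinv _ hp
    have h2 := congrArg Matrix.transpose h1
    simp only [Matrix.transpose_mul, Matrix.transpose_transpose, sG _ hp, sH _ hp,
      ← Matrix.mul_assoc] at h2
    simp [blockForm, Matrix.fromBlocks_transpose, Matrix.fromBlocks_multiply, sG _ hp, sH _ hp,
      h1, h2]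
  · intro p hp k i j
    have hτ : ∀ c, partialDeriv c (traceForm (blockMetric G H) toricForm (blockForm M)) p
        = partialDeriv c (fun q => (M (action q)).trace) p := by
      intro c
      have : traceForm (blockMetric G H) toricForm (blockForm M) =ᶠ[𝓝 p]
          fun q => (M (action q)).trace := by
        filter_upwards [hopen.mem_nhds hp] with q hq
        exact traceForm_block (hGH _ hq) (sG _ hq)
      rw [partialDeriv, partialDeriv, this.fderiv_eq]
    have hG1 := fun a i j => partialDeriv_action_inl (hG _ hp i j) a
    have hG2 := fun a i j => partialDeriv_action_inr (hG _ hp i j) a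
    have hH1 := fun a i j => partialDeriv_action_inl (hH _ hp i j) a
    have hH2 := fun a i j => partialDeriv_action_inr (hH _ hp i j) a
    have hM1 := fun a i j => partialDeriv_action_inl (hM' _ hp i j) a
    have hM1' := fun a i j => partialDeriv_action_inl (hM' _ hp i j).neg a
    have hM2 := fun a i j => partialDeriv_action_inr (hM' _ hp i j) a
    have hM2' := fun a i j => partialDeriv_action_inr (hM' _ hp i j).neg a
    have hT1 := fun a => partialDeriv_action_inl (hT _ hp) a
    have hT2 := fun a => partialDeriv_action_inr (hT _ hp) a
    have hneg : ∀ a i j, partialDeriv a (-fun n => M n i j) (action p)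
        = - partialDeriv a (fun n => M n i j) (action p) := by
      intro a i j
      rw [partialDeriv, fderiv_neg]
      rfl
    have sym : ∀ i j, H (action p) i j = H (action p) j i := fun i j =>
      congrFun (congrFun (sH _ hp) j) i
    have symG : ∀ i j, G (action p) i j = G (action p) j i := fun i j =>
      congrFun (congrFun (sG _ hp) j) i
    simp only [hτ, covDeriv, christoffel, inv_blockMetric (hGH _ hp),
      complexStructure_block (hGH _ hp)]
    have E1 := e₁ _ hp
    have E2 := e₂ _ hp
    have E3 := e₃ _ hp
    simp only [Pi.neg_apply] at hM1' hM2'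
    rcases k with k | k <;> rcases i with i | i <;> rcases j with j | j
    all_goals simp [blockMetric, blockForm, toricForm, partialDeriv_const, hG1, hG2, hH1, hH2,
      hM1, hM1', hM2, hM2', hT1, hT2, hneg]
    · have := E1 k i j
      simp only [Fin.sum_univ_two] at this
      linear_combination this
    · have := E1 k j i
      simp only [Fin.sum_univ_two] at this
      linear_combination -this
    · have := E2 k i j
      simp only [Fin.sum_univ_two] at this
      linear_combination this
    · have := E3 k i j
      simp only [Fin.sum_univ_two] at this
      linear_combination this
  · rintro ⟨t, ht⟩
    obtain ⟨m, hm, h⟩ := hnt t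
    have := ht (Sum.elim m 0) hm
    rw [blockForm, toricForm, Matrix.fromBlocks_smul, Matrix.fromBlocks_inj] at this
    exact h this.2.1

end

/-! ### The separable metric and its Hamiltonian 2-form -/

namespace BilinearChart

variable (c : BilinearChart)

/-- The inverse metric `(A(x) ∂ₓ² + B(y) ∂ᵧ²) / jac` on the image of the chart. -/
def invMetric (A B : ℝ → ℝ) (m : Fin 2 → ℝ) : Matrix (Fin 2) (Fin 2) ℝ :=
  Matrix.of fun i j => (A (c.X m) * (c.vf m i * c.vf m j) + B (c.Y m) * (c.wf m i * c.wf m j))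
    / c.jf m

/-- The metric `jac (dx² / A(x) + dy² / B(y))` on the image of the chart. -/
def metric (A B : ℝ → ℝ) (m : Fin 2 → ℝ) : Matrix (Fin 2) (Fin 2) ℝ :=
  Matrix.of fun i j => c.jf m * (c.dx m i * c.dx m j / A (c.X m) + c.dy m i * c.dy m j / B (c.Y m))

/-- The coefficients of the Hamiltonian 2-form, with eigenvalues `d₁ x` and `-(d₀ + d₂ y)`, whose
difference is the Jacobian. -/
def hamForm (m : Fin 2 → ℝ) : Matrix (Fin 2) (Fin 2) ℝ :=
  Matrix.of fun i j => c.d₁ * c.X m * (c.dx m i * c.vf m j)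
    + (c.d₁ * c.X m - c.jf m) * (c.dy m i * c.wf m j)

variable {c} {m : Fin 2 → ℝ}

lemma dx_vf (hm : m ∈ c.image) : ∑ n, c.dx m n * c.vf m n = 1 := by
  have h := c.nX_dot_v (c.X m) (c.Y m)
  have := jf_ne_zero hm
  simp only [dotProduct, Fin.sum_univ_two] at h
  simp only [Fin.sum_univ_two, dx, vf, jf] at *
  field_simp
  exact h

lemma dx_wf : ∑ n, c.dx m n * c.wf m n = 0 := by
  have h := c.nX_dot_w (c.X m)
  simp only [dotProduct, Fin.sum_univ_two] at h
  simp only [Fin.sum_univ_two, dx, wf]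
  rw [div_mul_eq_mul_div, div_mul_eq_mul_div, ← add_div, h, zero_div]

lemma dy_vf : ∑ n, c.dy m n * c.vf m n = 0 := by
  have h := c.nY_dot_v (c.Y m)
  simp only [dotProduct, Fin.sum_univ_two] at h
  simp only [Fin.sum_univ_two, dy, vf]
  rw [div_mul_eq_mul_div, div_mul_eq_mul_div, ← add_div, h, zero_div]

lemma dy_wf (hm : m ∈ c.image) : ∑ n, c.dy m n * c.wf m n = 1 := by
  have h := c.nY_dot_w (c.X m) (c.Y m)
  have := jf_ne_zero hm
  simp only [dotProduct, Fin.sum_univ_two] at h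
  simp only [Fin.sum_univ_two, dy, wf, jf] at *
  field_simp
  exact h

/-- Contraction of a vector with a covector, both expanded in the frame. -/
lemma contract (hm : m ∈ c.image) {a b : Fin 2 → ℝ} {h₁ h₂ t₁ t₂ : ℝ}
    (ha : ∀ n, a n = h₁ * c.vf m n + h₂ * c.wf m n)
    (hb : ∀ n, b n = t₁ * c.dx m n + t₂ * c.dy m n) :
    ∑ n, a n * b n = h₁ * t₁ + h₂ * t₂ := by
  have e1 := dx_vf hm
  have e2 := dx_wf (m := m) (c := c)
  have e3 := dy_vf (m := m) (c := c)
  have e4 := dy_wf hm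
  simp only [ha, hb, Fin.sum_univ_two] at *
  linear_combination h₁ * t₁ * e1 + h₂ * t₁ * e2 + h₁ * t₂ * e3 + h₂ * t₂ * e4

lemma contract' (hm : m ∈ c.image) {a b : Fin 2 → ℝ} {h₁ h₂ t₁ t₂ : ℝ}
    (ha : ∀ n, a n = h₁ * c.dx m n + h₂ * c.dy m n)
    (hb : ∀ n, b n = t₁ * c.vf m n + t₂ * c.wf m n) :
    ∑ n, a n * b n = h₁ * t₁ + h₂ * t₂ := by
  simp only [mul_comm (a _), mul_comm h₁, mul_comm h₂]
  exact contract hm hb ha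

lemma frame_complete (hm : m ∈ c.image) (i j : Fin 2) :
    (1 : Matrix (Fin 2) (Fin 2) ℝ) i j = c.dx m i * c.vf m j + c.dy m i * c.wf m j := by
  have h := congrFun (c.frame_expand (jf_ne_zero hm) (Pi.single i 1)) j
  simp only [Pi.add_apply, Pi.smul_apply, smul_eq_mul, dotProduct_single, mul_one] at h
  simp only [dx, dy, vf, wf]
  rw [Matrix.one_apply]
  refine Eq.trans ?_ h.symm
  simp only [Pi.single_apply, eq_comm]

lemma frame_complete' (hm : m ∈ c.image) (i j : Fin 2) :
    (1 : Matrix (Fin 2) (Fin 2) ℝ) i j = c.dx m j * c.vf m i + c.dy m j * c.wf m i := by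
  rw [← frame_complete hm, Matrix.one_apply, Matrix.one_apply]
  simp only [eq_comm]

section

variable {A B : ℝ → ℝ} {A' B' : ℝ}

lemma metric_mul_invMetric (hm : m ∈ c.image) (hA : A (c.X m) ≠ 0) (hB : B (c.Y m) ≠ 0) :
    c.metric A B m * c.invMetric A B m = 1 := by
  have := jf_ne_zero hm
  ext i j
  rw [Matrix.mul_apply, frame_complete hm,
    contract' hm (h₁ := c.jf m * c.dx m i / A (c.X m)) (h₂ := c.jf m * c.dy m i / B (c.Y m))
      (t₁ := A (c.X m) * c.vf m j / c.jf m) (t₂ := B (c.Y m) * c.wf m j / c.jf m)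
      (fun n => by simp only [metric, Matrix.of_apply]; ring)
      (fun n => by simp only [invMetric, Matrix.of_apply]; ring)]
  field_simp

lemma invMetric_transpose : (c.invMetric A B m)ᵀ = c.invMetric A B m := by
  ext i j
  simp only [Matrix.transpose_apply, invMetric, Matrix.of_apply]
  ring

lemma metric_transpose : (c.metric A B m)ᵀ = c.metric A B m := by
  ext i j
  simp only [Matrix.transpose_apply, metric, Matrix.of_apply]
  ring

lemma trace_hamForm (hm : m ∈ c.image) : (c.hamForm m).trace = 2 * c.d₁ * c.X m - c.jf m := by
  have e1 := dx_vf hm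
  have e4 := dy_wf hm
  simp only [Matrix.trace, Matrix.diag, hamForm, Matrix.of_apply, Fin.sum_univ_two] at *
  linear_combination (c.d₁ * c.X m) * e1 + (c.d₁ * c.X m - c.jf m) * e4

lemma invMetric_hamForm_metric (hm : m ∈ c.image) (hA : A (c.X m) ≠ 0) (hB : B (c.Y m) ≠ 0) :
    c.invMetric A B m * c.hamForm m * c.metric A B m = (c.hamForm m)ᵀ := by
  have := jf_ne_zero hm
  have h : ∀ i j, (c.invMetric A B m * c.hamForm m) i j =
      A (c.X m) * c.vf m i / c.jf m * (c.d₁ * c.X m) * c.vf m j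
      + B (c.Y m) * c.wf m i / c.jf m * (c.d₁ * c.X m - c.jf m) * c.wf m j := by
    intro i j
    rw [Matrix.mul_apply, contract hm (h₁ := A (c.X m) * c.vf m i / c.jf m)
      (h₂ := B (c.Y m) * c.wf m i / c.jf m) (t₁ := c.d₁ * c.X m * c.vf m j)
      (t₂ := (c.d₁ * c.X m - c.jf m) * c.wf m j)
      (fun n => by simp only [invMetric, Matrix.of_apply]; ring)
      (fun n => by simp only [hamForm, Matrix.of_apply]; ring)]
    ring
  ext i j
  rw [Matrix.mul_apply, contract hm (h i) (t₁ := c.jf m * c.dx m j / A (c.X m))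
    (t₂ := c.jf m * c.dy m j / B (c.Y m))
    (fun n => by simp only [metric, Matrix.of_apply]; ring)]
  simp only [Matrix.transpose_apply, hamForm, Matrix.of_apply]
  field_simp

lemma hasPartials_hamForm (hm : m ∈ c.image) (i j : Fin 2) :
    c.HasPartials (fun n => c.hamForm n i j)
      (c.d₁ * (c.dx m i * c.vf m j) - c.d₁ * c.X m * c.ly m * c.dy m i * c.vf m j
        + (c.d₁ * c.X m - c.jf m) *
          (-(c.lx m * c.dy m i) * c.wf m j + c.dy m i * (c.ly m * c.vf m j + c.lx m * c.wf m j)))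
      (c.d₁ * c.X m * (-(c.ly m * c.dx m i) * c.vf m j
          + c.dx m i * (c.ly m * c.vf m j + c.lx m * c.wf m j))
        - c.d₂ * (c.dy m i * c.wf m j)
        - (c.d₁ * c.X m - c.jf m) * c.lx m * c.dx m i * c.wf m j) m := by
  have hj := jf_ne_zero hm
  have hX := (hasPartials_const c.d₁ m).mul (hasPartials_X hm)
  have h := (hX.mul ((hasPartials_dx hm i).mul (hasPartials_vf hm j))).add
    ((hX.add ((hasPartials_const (-1) m).mul (hasPartials_jf hm))).mul
      ((hasPartials_dy hm i).mul (hasPartials_wf hm j)))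
  refine (h.congr_of_eventuallyEq (Eventually.of_forall fun n => ?_)).congr ?_ ?_
  · simp only [hamForm, Matrix.of_apply]; ring
  · simp only [lx, ly]; field_simp; ring
  · simp only [lx, ly]; field_simp; ring

lemma hasPartials_invMetric (hm : m ∈ c.image) (hA : HasDerivAt A A' (c.X m))
    (hB : HasDerivAt B B' (c.Y m)) (i j : Fin 2) :
    c.HasPartials (fun n => c.invMetric A B n i j)
      (((A' - c.lx m * A (c.X m)) * (c.vf m i * c.vf m j) + B (c.Y m) *
        (c.ly m * (c.vf m i * c.wf m j + c.wf m i * c.vf m j) + c.lx m * (c.wf m i * c.wf m j)))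
          / c.jf m)
      (((B' - c.ly m * B (c.Y m)) * (c.wf m i * c.wf m j) + A (c.X m) *
        (c.lx m * (c.vf m i * c.wf m j + c.wf m i * c.vf m j) + c.ly m * (c.vf m i * c.vf m j)))
          / c.jf m) m := by
  have hj := jf_ne_zero hm
  have h := (((hasPartials_comp_X hm hA).mul ((hasPartials_vf hm i).mul (hasPartials_vf hm j))).add
    ((hasPartials_comp_Y hm hB).mul ((hasPartials_wf hm i).mul (hasPartials_wf hm j)))).div
      (hasPartials_jf hm) hj
  refine h.congr ?_ ?_
  · field_simp; ring
  · field_simp; ring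

lemma hasPartials_metric (hm : m ∈ c.image) (hA : HasDerivAt A A' (c.X m))
    (hB : HasDerivAt B B' (c.Y m)) (hA0 : A (c.X m) ≠ 0) (hB0 : B (c.Y m) ≠ 0) (i j : Fin 2) :
    c.HasPartials (fun n => c.metric A B n i j)
      (c.jf m * ((c.lx m / A (c.X m) - A' / A (c.X m) ^ 2) * (c.dx m i * c.dx m j)
        - c.ly m / A (c.X m) * (c.dy m i * c.dx m j + c.dx m i * c.dy m j)
        - c.lx m / B (c.Y m) * (c.dy m i * c.dy m j)))
      (c.jf m * ((c.ly m / B (c.Y m) - B' / B (c.Y m) ^ 2) * (c.dy m i * c.dy m j)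
        - c.lx m / B (c.Y m) * (c.dy m i * c.dx m j + c.dx m i * c.dy m j)
        - c.ly m / A (c.X m) * (c.dx m i * c.dx m j))) m := by
  have hj := jf_ne_zero hm
  have h := (hasPartials_jf hm).mul
    ((((hasPartials_dx hm i).mul (hasPartials_dx hm j)).div (hasPartials_comp_X hm hA) hA0).add
    (((hasPartials_dy hm i).mul (hasPartials_dy hm j)).div (hasPartials_comp_Y hm hB) hB0))
  refine h.congr ?_ ?_
  · field_simp; ring
  · field_simp; ring

lemma hasPartials_trace (hm : m ∈ c.image) :
    c.HasPartials (fun n => (c.hamForm n).trace) c.d₁ (-c.d₂) m := by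
  have hj := jf_ne_zero hm
  have h := ((hasPartials_const (2 * c.d₁) m).mul (hasPartials_X hm)).add
    ((hasPartials_const (-1) m).mul (hasPartials_jf hm))
  refine (h.congr_of_eventuallyEq ?_).congr ?_ ?_
  · filter_upwards [c.isOpen_image.mem_nhds hm] with n hn
    rw [trace_hamForm hn]
    ring
  · simp only [lx]; field_simp; ring
  · simp only [ly]; field_simp; ring

end

lemma contDiffOn_jf : ContDiffOn ℝ ∞ c.jf c.image :=
  (contDiffOn_const.add (contDiffOn_const.mul c.contDiffOn_X)).add
    (contDiffOn_const.mul c.contDiffOn_Y)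

lemma contDiffOn_vf (i : Fin 2) : ContDiffOn ℝ ∞ (fun m => c.vf m i) c.image :=
  contDiffOn_const.add (c.contDiffOn_Y.mul contDiffOn_const)

lemma contDiffOn_wf (i : Fin 2) : ContDiffOn ℝ ∞ (fun m => c.wf m i) c.image :=
  contDiffOn_const.add (c.contDiffOn_X.mul contDiffOn_const)

lemma contDiffOn_dx (i : Fin 2) : ContDiffOn ℝ ∞ (fun m => c.dx m i) c.image := by
  refine ContDiffOn.div ?_ contDiffOn_jf fun m hm => jf_ne_zero hm
  fin_cases i
  · exact contDiffOn_const.mul (contDiffOn_wf 1)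
  · exact (contDiffOn_const.mul (contDiffOn_wf 0)).neg

lemma contDiffOn_dy (i : Fin 2) : ContDiffOn ℝ ∞ (fun m => c.dy m i) c.image := by
  refine ContDiffOn.div ?_ contDiffOn_jf fun m hm => jf_ne_zero hm
  fin_cases i
  · exact (contDiffOn_const.mul (contDiffOn_vf 1)).neg
  · exact contDiffOn_const.mul (contDiffOn_vf 0)

lemma contDiffOn_hamForm (i j : Fin 2) : ContDiffOn ℝ ∞ (fun m => c.hamForm m i j) c.image :=
  ((contDiffOn_const.mul c.contDiffOn_X).mul ((contDiffOn_dx i).mul (contDiffOn_vf j))).add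
    (((contDiffOn_const.mul c.contDiffOn_X).sub contDiffOn_jf).mul
      ((contDiffOn_dy i).mul (contDiffOn_wf j)))

lemma contDiffOn_invMetric {A B : ℝ → ℝ} (hA : ContDiff ℝ ∞ A) (hB : ContDiff ℝ ∞ B)
    (i j : Fin 2) : ContDiffOn ℝ ∞ (fun m => c.invMetric A B m i j) c.image :=
  (((hA.comp_contDiffOn c.contDiffOn_X).mul ((contDiffOn_vf i).mul (contDiffOn_vf j))).add
    ((hB.comp_contDiffOn c.contDiffOn_Y).mul ((contDiffOn_wf i).mul (contDiffOn_wf j)))).div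
      contDiffOn_jf fun _ hm => jf_ne_zero hm

/-- The two eigenvalues of the 2-form differ by the Jacobian, so it is not a multiple of the
symplectic form. -/
lemma hamForm_ne_smul_one (hm : m ∈ c.image) (t : ℝ) :
    c.hamForm m ≠ t • (1 : Matrix (Fin 2) (Fin 2) ℝ) := by
  intro h
  have F : ∀ i j, (c.d₁ * c.X m - t) * (c.dx m i * c.vf m j)
      + (c.d₁ * c.X m - c.jf m - t) * (c.dy m i * c.wf m j) = 0 := by
    intro i j
    have := congrFun (congrFun h i) j
    rw [Matrix.smul_apply, frame_complete hm, smul_eq_mul, hamForm, Matrix.of_apply] at this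
    linear_combination this
  have hv : ∀ j, (c.d₁ * c.X m - t) * c.vf m j = 0 := by
    intro j
    have := contract hm (a := c.vf m) (b := fun _ => 0) (h₁ := 1) (h₂ := 0)
      (t₁ := (c.d₁ * c.X m - t) * c.vf m j) (t₂ := (c.d₁ * c.X m - c.jf m - t) * c.wf m j)
      (fun n => by ring) (fun n => by rw [← F n j]; ring)
    simpa using this.symm
  have hw : ∀ j, (c.d₁ * c.X m - c.jf m - t) * c.wf m j = 0 := by
    intro j
    have := contract hm (a := c.wf m) (b := fun _ => 0) (h₁ := 0) (h₂ := 1)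
      (t₁ := (c.d₁ * c.X m - t) * c.vf m j) (t₂ := (c.d₁ * c.X m - c.jf m - t) * c.wf m j)
      (fun n => by ring) (fun n => by rw [← F n j]; ring)
    simpa using this.symm
  have e1 := dx_vf hm
  have e4 := dy_wf hm
  simp only [Fin.sum_univ_two] at e1 e4
  apply jf_ne_zero hm
  linear_combination -(c.d₁ * c.X m - t) * e1 + (c.d₁ * c.X m - c.jf m - t) * e4
    + c.dx m 0 * hv 0 + c.dx m 1 * hv 1 - c.dy m 0 * hw 0 - c.dy m 1 * hw 1

section

variable {A B : ℝ → ℝ} {A' B' : ℝ}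

lemma invMetric_eq (l n : Fin 2) : c.invMetric A B m l n =
    (A (c.X m) / c.jf m) * c.vf m l * c.vf m n + (B (c.Y m) / c.jf m) * c.wf m l * c.wf m n := by
  simp only [invMetric, Matrix.of_apply]; ring

lemma metric_eq (l n : Fin 2) : c.metric A B m l n =
    (c.jf m / A (c.X m)) * c.dx m l * c.dx m n + (c.jf m / B (c.Y m)) * c.dy m l * c.dy m n := by
  simp only [metric, Matrix.of_apply]; ring

lemma hamForm_eq (l n : Fin 2) : c.hamForm m l n =
    c.d₁ * c.X m * c.dx m l * c.vf m n + (c.d₁ * c.X m - c.jf m) * c.dy m l * c.wf m n := by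
  simp only [hamForm, Matrix.of_apply]; ring

/-- The Christoffel symbols of the metric on the plane of the actions, expanded in the frame. -/
lemma sum_invMetric_partialDeriv_metric (hm : m ∈ c.image) (hA : HasDerivAt A A' (c.X m))
    (hB : HasDerivAt B B' (c.Y m)) (hA0 : A (c.X m) ≠ 0) (hB0 : B (c.Y m) ≠ 0) (l k i : Fin 2) :
    ∑ n, c.invMetric A B m l n * (partialDeriv k (fun q => c.metric A B q i n) m
      + partialDeriv i (fun q => c.metric A B q k n) m
      - partialDeriv n (fun q => c.metric A B q k i) m) =
    (A (c.X m) / c.jf m * (c.jf m * ((c.lx m / A (c.X m) - A' / A (c.X m) ^ 2)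
        * (c.dx m k * c.dx m i)
        - c.ly m / A (c.X m) * (c.dx m k * c.dy m i + c.dy m k * c.dx m i)
        - c.lx m / B (c.Y m) * (c.dy m k * c.dy m i)))) * c.vf m l
      + (B (c.Y m) / c.jf m * (c.jf m * ((c.ly m / B (c.Y m) - B' / B (c.Y m) ^ 2)
        * (c.dy m k * c.dy m i)
        - c.lx m / B (c.Y m) * (c.dx m k * c.dy m i + c.dy m k * c.dx m i)
        - c.ly m / A (c.X m) * (c.dx m k * c.dx m i)))) * c.wf m l := by
  rw [mul_right_comm _ _ (c.vf m l), mul_right_comm _ _ (c.wf m l)]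
  refine contract hm (invMetric_eq l) fun n => ?_
  simp only [(hasPartials_metric hm hA hB hA0 hB0 _ _).partialDeriv]
  ring

lemma sum_metric_partialDeriv_invMetric (hm : m ∈ c.image) (hA : HasDerivAt A A' (c.X m))
    (hB : HasDerivAt B B' (c.Y m)) (l k j : Fin 2) :
    ∑ n, c.metric A B m l n * partialDeriv k (fun q => c.invMetric A B q j n) m =
    (c.jf m / A (c.X m) * ((c.dx m k * ((A' - c.lx m * A (c.X m)) * c.vf m j
        + c.ly m * B (c.Y m) * c.wf m j)
        + c.dy m k * A (c.X m) * (c.ly m * c.vf m j + c.lx m * c.wf m j)) / c.jf m)) * c.dx m l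
      + (c.jf m / B (c.Y m) * ((c.dy m k * ((B' - c.ly m * B (c.Y m)) * c.wf m j
        + c.lx m * A (c.X m) * c.vf m j)
        + c.dx m k * B (c.Y m) * (c.ly m * c.vf m j + c.lx m * c.wf m j)) / c.jf m))
          * c.dy m l := by
  rw [mul_right_comm _ _ (c.dx m l), mul_right_comm _ _ (c.dy m l)]
  refine contract' hm (metric_eq l) fun n => ?_
  simp only [(hasPartials_invMetric hm hA hB _ _).partialDeriv]
  ring

lemma sum_invMetric_partialDeriv (hm : m ∈ c.image) {f : (Fin 2 → ℝ) → ℝ} {a b : ℝ}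
    (hf : c.HasPartials f a b m) (l : Fin 2) :
    ∑ n, c.invMetric A B m l n * partialDeriv n f m =
      (A (c.X m) / c.jf m * a) * c.vf m l + (B (c.Y m) / c.jf m * b) * c.wf m l := by
  rw [mul_right_comm _ _ (c.vf m l), mul_right_comm _ _ (c.wf m l)]
  exact contract hm (invMetric_eq l) fun n => hf.partialDeriv n

lemma sum_partialDeriv_invMetric (hm : m ∈ c.image) {f : (Fin 2 → ℝ) → ℝ} {a b : ℝ}
    (hf : c.HasPartials f a b m) (l : Fin 2) :
    ∑ n, partialDeriv n f m * c.invMetric A B m n l =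
      (A (c.X m) / c.jf m * a) * c.vf m l + (B (c.Y m) / c.jf m * b) * c.wf m l := by
  rw [← sum_invMetric_partialDeriv hm hf]
  refine Finset.sum_congr rfl fun n _ => ?_
  rw [mul_comm, ← congrFun (congrFun invMetric_transpose n) l, Matrix.transpose_apply]

lemma sum_mul_hamForm (hm : m ∈ c.image) (t P Q : ℝ) (j : Fin 2) :
    ∑ l, (t * (P * c.vf m l + Q * c.wf m l)) * c.hamForm m l j =
      t * (P * (c.d₁ * c.X m) * c.vf m j + Q * (c.d₁ * c.X m - c.jf m) * c.wf m j) := by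
  rw [contract hm (h₁ := t * P) (h₂ := t * Q) (t₁ := c.d₁ * c.X m * c.vf m j)
    (t₂ := (c.d₁ * c.X m - c.jf m) * c.wf m j) (fun n => by ring)
    (fun n => by rw [hamForm_eq]; ring)]
  ring

lemma sum_mul_hamForm' (hm : m ∈ c.image) (t P Q : ℝ) (i : Fin 2) :
    ∑ l, (t * (P * c.dx m l + Q * c.dy m l)) * c.hamForm m i l =
      t * (P * (c.d₁ * c.X m) * c.dx m i + Q * (c.d₁ * c.X m - c.jf m) * c.dy m i) := by
  rw [contract' hm (h₁ := t * P) (h₂ := t * Q) (t₁ := c.d₁ * c.X m * c.dx m i)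
    (t₂ := (c.d₁ * c.X m - c.jf m) * c.dy m i) (fun n => by ring)
    (fun n => by rw [hamForm_eq])]
  ring

end

/-- The 2-form with eigenvalues `d₁ x` and `-(d₀ + d₂ y)` is Hamiltonian for every separable
metric. -/
theorem isHamiltonianTwoForm {O : Set (Fin 2 → ℝ)} (hO : IsOpen O) (hne : O.Nonempty)
    (hsub : O ⊆ c.image)
    {A B : ℝ → ℝ} (dA : Differentiable ℝ A) (dB : Differentiable ℝ B)
    (hA : ∀ m ∈ O, A (c.X m) ≠ 0) (hB : ∀ m ∈ O, B (c.Y m) ≠ 0)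
    {G : (Fin 2 → ℝ) → Matrix (Fin 2) (Fin 2) ℝ} (hG : ∀ m ∈ O, G m = c.metric A B m) :
    IsHamiltonianTwoForm {p | action p ∈ O} (blockMetric G (c.invMetric A B)) toricForm
      (blockForm c.hamForm) := by
  have eG : ∀ m ∈ O, ∀ i j, (fun n => G n i j) =ᶠ[𝓝 m] fun n => c.metric A B n i j :=
    fun m hm i j => by filter_upwards [hO.mem_nhds hm] with n hn using by rw [hG n hn]
  have eG' : ∀ m ∈ O, ∀ k i j, partialDeriv k (fun n => G n i j) m
      = partialDeriv k (fun n => c.metric A B n i j) m := fun m hm k i j => by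
    rw [partialDeriv, (eG m hm i j).fderiv_eq, partialDeriv]
  have d1 : ∀ m ∈ O, c.d₁ = c.lx m * c.jf m := fun m hm => by
    simp only [lx, div_mul_cancel₀ _ (jf_ne_zero (hsub hm))]
  have d2 : ∀ m ∈ O, c.d₂ = c.ly m * c.jf m := fun m hm => by
    simp only [ly, div_mul_cancel₀ _ (jf_ne_zero (hsub hm))]
  refine isHamiltonianTwoForm_block hO (fun m hm i j => ?_)
    (fun m hm i j => (hasPartials_invMetric (hsub hm) (dA _).hasDerivAt (dB _).hasDerivAt
      i j).differentiableAt) ?_ ?_ ?_ (fun _ _ => invMetric_transpose) ?_ ?_ ?_ ?_ ?_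
  · exact ((hasPartials_metric (hsub hm) (dA _).hasDerivAt (dB _).hasDerivAt (hA m hm) (hB m hm)
      i j).congr_of_eventuallyEq (eG m hm i j)).differentiableAt
  · exact fun i j => (contDiffOn_hamForm i j).mono hsub
  · intro m hm
    rw [hG m hm, metric_mul_invMetric (hsub hm) (hA m hm) (hB m hm)]
  · intro m hm
    rw [hG m hm, metric_transpose]
  · intro m hm
    rw [hG m hm, invMetric_hamForm_metric (hsub hm) (hA m hm) (hB m hm)]
  · exact fun t => hne.imp fun m hm => ⟨hm, hamForm_ne_smul_one (hsub hm) t⟩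
  · intro m hm k i j
    have hm' := hsub hm
    have hj := jf_ne_zero hm'
    have hA0 := hA m hm
    have hB0 := hB m hm
    simp only [eG' m hm, hG m hm, sum_invMetric_partialDeriv_metric hm' (dA _).hasDerivAt
      (dB _).hasDerivAt hA0 hB0, sum_metric_partialDeriv_invMetric hm' (dA _).hasDerivAt
      (dB _).hasDerivAt, sum_mul_hamForm hm', sum_mul_hamForm' hm',
      sum_partialDeriv_invMetric hm' (hasPartials_trace hm'),
      (hasPartials_hamForm hm' _ _).partialDeriv, frame_complete hm']
    simp only [metric_eq, (hasPartials_trace hm').partialDeriv]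
    generalize deriv A (c.X m) = A'
    generalize deriv B (c.Y m) = B'
    generalize hf : c.d₁ * c.X m = f
    rw [d1 m hm, d2 m hm]
    field_simp
    ring
  · intro m hm k i j
    have hm' := hsub hm
    have hj := jf_ne_zero hm'
    have hA0 := hA m hm
    have hB0 := hB m hm
    simp only [hG m hm, sum_metric_partialDeriv_invMetric hm' (dA _).hasDerivAt
      (dB _).hasDerivAt, sum_mul_hamForm' hm', (hasPartials_trace hm').partialDeriv,
      frame_complete' hm']
    generalize deriv A (c.X m) = A'
    generalize deriv B (c.Y m) = B'
    generalize hf : c.d₁ * c.X m = f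
    rw [d1 m hm, d2 m hm]
    field_simp
    ring
  · intro m hm k i j
    have hm' := hsub hm
    have hj := jf_ne_zero hm'
    simp only [sum_invMetric_partialDeriv hm' (hasPartials_invMetric hm' (dA _).hasDerivAt
      (dB _).hasDerivAt _ _), sum_mul_hamForm hm',
      sum_partialDeriv_invMetric hm' (hasPartials_trace hm')]
    simp only [invMetric_eq]
    generalize deriv A (c.X m) = A'
    generalize deriv B (c.Y m) = B'
    generalize hf : c.d₁ * c.X m = f
    rw [d1 m hm, d2 m hm]
    field_simp
    ring

end BilinearChart

/-! ### Profile functions of one variable -/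

/-- A smooth function on `(0, 1)` has a smooth antiderivative there. -/
lemma exists_antideriv {h : ℝ → ℝ} (hh : ContDiffOn ℝ ∞ h (Ioo 0 1)) :
    ∃ F : ℝ → ℝ, ContDiffOn ℝ ∞ F (Ioo 0 1) ∧ ∀ x ∈ Ioo (0 : ℝ) 1, HasDerivAt F (h x) x := by
  have hd : ∀ x ∈ Ioo (0 : ℝ) 1, HasDerivAt (fun x => ∫ t in (1 / 2)..x, h t) (h x) x := by
    intro x hx
    have hsub : uIcc (1 / 2) x ⊆ Ioo (0 : ℝ) 1 :=
      ordConnected_Ioo.uIcc_subset ⟨by norm_num, by norm_num⟩ hx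
    exact intervalIntegral.integral_hasDerivAt_right
      (hh.continuousOn.mono hsub).intervalIntegrable
      (hh.continuousOn.stronglyMeasurableAtFilter isOpen_Ioo x hx)
      (hh.continuousOn.continuousAt (isOpen_Ioo.mem_nhds hx))
  refine ⟨_, ?_, hd⟩
  rw [contDiffOn_infty_iff_deriv_of_isOpen isOpen_Ioo]
  exact ⟨fun x hx => (hd x hx).differentiableAt.differentiableWithinAt,
    hh.congr fun x hx => (hd x hx).deriv⟩

/-- The quadratic polynomial with coefficients `α`, `β`, `γ`. -/
def quad (α β γ x : ℝ) : ℝ := α * x ^ 2 + β * x + γ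

lemma contDiff_quad (α β γ : ℝ) : ContDiff ℝ ∞ (quad α β γ) := by
  unfold quad
  fun_prop

lemma hasDerivAt_quad (α β γ x : ℝ) : HasDerivAt (quad α β γ) (2 * α * x + β) x := by
  have h := (((hasDerivAt_pow 2 x).const_mul α).add ((hasDerivAt_id x).const_mul β)).add_const γ
  refine h.congr_deriv ?_
  simp
  ring

/-- The integral from `0` to `x` of the quadratic polynomial against the weight `exp (-2bt)`. -/
def quadInt (b α β γ x : ℝ) : ℝ := ∫ t in (0)..x, Real.exp (-(2 * b * t)) * quad α β γ t

lemma continuous_weight_quad (b α β γ : ℝ) :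
    Continuous fun t => Real.exp (-(2 * b * t)) * quad α β γ t := by
  have := (contDiff_quad α β γ).continuous
  fun_prop

lemma hasDerivAt_quadInt (b α β γ x : ℝ) :
    HasDerivAt (quadInt b α β γ) (Real.exp (-(2 * b * x)) * quad α β γ x) x :=
  (continuous_weight_quad b α β γ).integral_hasStrictDerivAt 0 x |>.hasDerivAt

lemma contDiff_quadInt (b α β γ : ℝ) : ContDiff ℝ ∞ (quadInt b α β γ) := by
  rw [contDiff_infty_iff_deriv]
  refine ⟨fun x => (hasDerivAt_quadInt b α β γ x).differentiableAt, ?_⟩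
  have : deriv (quadInt b α β γ) = fun x => Real.exp (-(2 * b * x)) * quad α β γ x :=
    funext fun x => (hasDerivAt_quadInt b α β γ x).deriv
  rw [this]
  have := contDiff_quad α β γ
  fun_prop

/-- The solution of `A' - 2 b A = 2 (α x² + β x + γ)` with `A 0 = 0`. -/
def profile (b α β γ x : ℝ) : ℝ := 2 * Real.exp (2 * b * x) * quadInt b α β γ x

lemma contDiff_profile (b α β γ : ℝ) : ContDiff ℝ ∞ (profile b α β γ) := by
  have := contDiff_quadInt b α β γ
  unfold profile
  fun_prop

lemma hasDerivAt_profile (b α β γ x : ℝ) :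
    HasDerivAt (profile b α β γ) (2 * b * profile b α β γ x + 2 * quad α β γ x) x := by
  have h1 : HasDerivAt (fun x => 2 * Real.exp (2 * b * x)) (2 * (Real.exp (2 * b * x) * (2 * b))) x :=
    (((hasDerivAt_id x).const_mul (2 * b)).exp.congr_deriv (by simp)).const_mul 2
  refine (h1.mul (hasDerivAt_quadInt b α β γ x)).congr_deriv ?_
  rw [profile, Real.exp_neg]
  field_simp

lemma profile_zero (b α β γ : ℝ) : profile b α β γ 0 = 0 := by simp [profile, quadInt]

/-- A quadratic polynomial that is positive at `0` and negative at `1` cannot change sign from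
nonpositive to nonnegative in between: its third divided difference would not vanish. -/
lemma quad_sign {α β γ t x : ℝ} (h0 : 0 < quad α β γ 0) (h1 : quad α β γ 1 < 0) (ht : 0 < t)
    (htx : t < x) (hx : x < 1) (hqt : quad α β γ t ≤ 0) (hqx : 0 ≤ quad α β γ x) : False := by
  have key : quad α β γ 0 * ((x - t) * (1 - t) * (1 - x)) - quad α β γ t * (x * 1 * (1 - x))
      + quad α β γ x * (t * 1 * (1 - t)) - quad α β γ 1 * (t * x * (x - t)) = 0 := by
    simp only [quad]; ring
  have p0 := mul_pos h0 (mul_pos (mul_pos (sub_pos.2 htx) (sub_pos.2 (htx.trans hx)))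
    (sub_pos.2 hx))
  have p1 := mul_nonneg (neg_nonneg.2 hqt) (mul_pos (mul_pos (ht.trans htx) one_pos)
    (sub_pos.2 hx)).le
  have p2 := mul_nonneg hqx (mul_pos (mul_pos ht one_pos) (sub_pos.2 (htx.trans hx))).le
  have p3 := mul_pos (neg_pos.2 h1) (mul_pos (mul_pos ht (ht.trans htx)) (sub_pos.2 htx))
  linarith

/-- The profile is positive inside the interval: its weighted integrand changes sign once, from
positive to negative, and has total integral zero. -/
lemma profile_pos {b α β γ : ℝ} (h0 : 0 < quad α β γ 0) (h1 : quad α β γ 1 < 0)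
    (hI : quadInt b α β γ 1 = 0) {x : ℝ} (hx : x ∈ Ioo (0 : ℝ) 1) : 0 < profile b α β γ x := by
  refine mul_pos (by positivity) ?_
  have hc := continuous_weight_quad b α β γ
  rcases le_or_gt 0 (quad α β γ x) with hq | hq
  · refine intervalIntegral.intervalIntegral_pos_of_pos_on (hc.intervalIntegrable _ _)
      (fun t ht => mul_pos (Real.exp_pos _) ?_) hx.1
    by_contra hn
    exact quad_sign h0 h1 ht.1 ht.2 hx.2 (not_lt.1 hn) hq
  · have hadd : quadInt b α β γ x + ∫ t in x..1, Real.exp (-(2 * b * t)) * quad α β γ t = 0 := by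
      rw [← hI]
      exact intervalIntegral.integral_add_adjacent_intervals (hc.intervalIntegrable _ _)
        (hc.intervalIntegrable _ _)
    have hneg : 0 < ∫ t in x..1, -(Real.exp (-(2 * b * t)) * quad α β γ t) := by
      refine intervalIntegral.intervalIntegral_pos_of_pos_on (hc.neg.intervalIntegrable _ _)
        (fun t ht => ?_) hx.2
      rw [← mul_neg]
      refine mul_pos (Real.exp_pos _) (neg_pos.2 ?_)
      by_contra hn
      exact quad_sign h0 h1 hx.1 ht.1 ht.2 hq.le (not_lt.1 hn)
    rw [intervalIntegral.integral_neg] at hneg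
    linarith

/-- The first moment of the probability measure on `[0, 1]` with density proportional to
`exp (-2bt)`. -/
def moment₁ (b : ℝ) : ℝ := quadInt b 0 1 0 1 / quadInt b 0 0 1 1
/-- The second moment of the same measure. -/
def moment₂ (b : ℝ) : ℝ := quadInt b 1 0 0 1 / quadInt b 0 0 1 1

lemma quadInt_pos {b α β γ : ℝ} (h : ∀ t ∈ Ioo (0 : ℝ) 1, 0 < quad α β γ t) :
    0 < quadInt b α β γ 1 :=
  intervalIntegral.intervalIntegral_pos_of_pos_on
    ((continuous_weight_quad b α β γ).intervalIntegrable _ _)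
    (fun t ht => mul_pos (Real.exp_pos _) (h t ht)) one_pos

lemma quadInt_total_pos (b : ℝ) : 0 < quadInt b 0 0 1 1 :=
  quadInt_pos fun t _ => by simp [quad]

/-- The integral over the whole interval, in terms of the two moments. -/
lemma quadInt_one (b α β γ : ℝ) : quadInt b α β γ 1 =
    quadInt b 0 0 1 1 * (α * moment₂ b + β * moment₁ b + γ) := by
  have hc := fun α β γ => (continuous_weight_quad b α β γ).intervalIntegrable
    (μ := MeasureTheory.volume) 0 1
  have e : quadInt b α β γ 1 =
      α * quadInt b 1 0 0 1 + β * quadInt b 0 1 0 1 + γ * quadInt b 0 0 1 1 := by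
    simp only [quadInt]
    rw [← intervalIntegral.integral_const_mul, ← intervalIntegral.integral_const_mul,
      ← intervalIntegral.integral_const_mul, ← intervalIntegral.integral_add,
      ← intervalIntegral.integral_add]
    · congr 1
      ext t
      simp only [quad]
      ring
    · exact ((hc 1 0 0).const_mul α).add ((hc 0 1 0).const_mul β)
    · exact (hc 0 0 1).const_mul γ
    · exact (hc 1 0 0).const_mul α
    · exact (hc 0 1 0).const_mul β
  have := (quadInt_total_pos b).ne'
  rw [e, moment₁, moment₂]
  field_simp

lemma quad_moment_pos {b α β γ : ℝ} (h : ∀ t ∈ Ioo (0 : ℝ) 1, 0 < α * t ^ 2 + β * t + γ) :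
    0 < α * moment₂ b + β * moment₁ b + γ := by
  have := quadInt_pos (b := b) (α := α) (β := β) (γ := γ) h
  rw [quadInt_one] at this
  exact pos_of_mul_pos_right this (quadInt_total_pos b).le

/-- The profile vanishes at `1` if the weighted mean of the quadratic polynomial is zero. -/
lemma profile_one {b α β γ : ℝ} (h : α * moment₂ b + β * moment₁ b + γ = 0) :
    profile b α β γ 1 = 0 := by
  rw [profile, quadInt_one, h]
  simp

namespace BilinearChart

variable {c : BilinearChart} {m : Fin 2 → ℝ}

/-! ### Scalar curvature and divergence of separable metrics -/

/-- The divergence of a field whose partial derivatives are expanded in the frame. -/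
lemma sum_partialDeriv (hm : m ∈ c.image) {V : Fin 2 → (Fin 2 → ℝ) → ℝ} {p₁ p₂ r₁ r₂ : ℝ}
    (hV : ∀ j, c.HasPartials (V j) (p₁ * c.vf m j + p₂ * c.wf m j)
      (r₁ * c.vf m j + r₂ * c.wf m j) m) :
    ∑ j, partialDeriv j (V j) m = p₁ + r₂ := by
  have e1 := dx_vf hm
  have e2 := dx_wf (m := m) (c := c)
  have e3 := dy_vf (m := m) (c := c)
  have e4 := dy_wf hm
  simp only [(hV _).partialDeriv, Fin.sum_univ_two] at *
  linear_combination p₁ * e1 + p₂ * e2 + r₁ * e3 + r₂ * e4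

section

variable {A B : ℝ → ℝ}

lemma sum_partialDeriv_invMetric_row (hm : m ∈ c.image) (dA : Differentiable ℝ A)
    (dB : Differentiable ℝ B) (i : Fin 2) :
    ∑ j, partialDeriv j (fun n => c.invMetric A B n i j) m =
      (deriv A (c.X m) * c.vf m i + deriv B (c.Y m) * c.wf m i) / c.jf m := by
  have hj := jf_ne_zero hm
  rw [sum_partialDeriv hm fun j => (hasPartials_invMetric hm (dA _).hasDerivAt
    (dB _).hasDerivAt i j).congr
    (a' := (((deriv A (c.X m) - c.lx m * A (c.X m)) * c.vf m i
      + B (c.Y m) * c.ly m * c.wf m i) / c.jf m) * c.vf m j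
      + (B (c.Y m) * (c.ly m * c.vf m i + c.lx m * c.wf m i) / c.jf m) * c.wf m j)
    (b' := (A (c.X m) * (c.ly m * c.vf m i + c.lx m * c.wf m i) / c.jf m) * c.vf m j
      + (((deriv B (c.Y m) - c.ly m * B (c.Y m)) * c.wf m i
      + A (c.X m) * c.lx m * c.vf m i) / c.jf m) * c.wf m j) (by ring) (by ring)]
  field_simp
  ring

/-- The scalar curvature of a separable metric. -/
lemma scalarCurvature_invMetric (hm : m ∈ c.image) (hA : ContDiff ℝ ∞ A) (hB : ContDiff ℝ ∞ B) :
    scalarCurvature (c.invMetric A B) m =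
      -((deriv (deriv A) (c.X m) + deriv (deriv B) (c.Y m)) / c.jf m) := by
  have hj := jf_ne_zero hm
  have dA := hA.differentiable (by simp)
  have dB := hB.differentiable (by simp)
  have dA' := (contDiff_infty_iff_deriv.1 hA).2.differentiable (by simp)
  have dB' := (contDiff_infty_iff_deriv.1 hB).2.differentiable (by simp)
  have hdiff : ∀ i j, DifferentiableAt ℝ
      (fun n => partialDeriv j (fun z => c.invMetric A B z i j) n) m := by
    intro i j
    have h := (contDiffOn_invMetric hA hB i j (c := c)).fderiv_of_isOpen c.isOpen_image
      (m := ∞) (by simp)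
    exact ((h.clm_apply contDiffOn_const).contDiffAt
      (c.isOpen_image.mem_nhds hm)).differentiableAt (by simp)
  have hsum : ∀ i, ∑ j, partialDeriv i (partialDeriv j fun z => c.invMetric A B z i j) m =
      partialDeriv i (fun n => (deriv A (c.X n) * c.vf n i + deriv B (c.Y n) * c.wf n i)
        / c.jf n) m := by
    intro i
    have : (fun n => (deriv A (c.X n) * c.vf n i + deriv B (c.Y n) * c.wf n i) / c.jf n) =ᶠ[𝓝 m]
        fun n => ∑ j, partialDeriv j (fun z => c.invMetric A B z i j) n := by
      filter_upwards [c.isOpen_image.mem_nhds hm] with n hn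
      rw [sum_partialDeriv_invMetric_row hn dA dB]
    rw [partialDeriv, this.fderiv_eq, fderiv_fun_sum fun j _ => hdiff i j,
      sum_apply]
    rfl
  rw [scalarCurvature, Finset.sum_congr rfl fun i _ => hsum i, neg_inj,
    sum_partialDeriv hm fun i => ((((hasPartials_comp_X hm (dA' _).hasDerivAt).mul
      (hasPartials_vf hm i)).add ((hasPartials_comp_Y hm (dB' _).hasDerivAt).mul
      (hasPartials_wf hm i))).div (hasPartials_jf hm) hj).congr
    (a' := ((deriv (deriv A) (c.X m) + deriv B (c.Y m) * c.ly m - c.lx m * deriv A (c.X m))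
        / c.jf m) * c.vf m i
      + ((deriv B (c.Y m) * c.lx m - c.lx m * deriv B (c.Y m)) / c.jf m) * c.wf m i)
    (b' := ((deriv A (c.X m) * c.ly m - c.ly m * deriv A (c.X m)) / c.jf m) * c.vf m i
      + ((deriv (deriv B) (c.Y m) + deriv A (c.X m) * c.lx m - c.ly m * deriv B (c.Y m))
        / c.jf m) * c.wf m i)
    (by field_simp; ring) (by field_simp; ring)]
  field_simp
  ring

/-- The divergence of the vector field `H(a, ·)` of a separable metric. -/
lemma divContract_invMetric (hm : m ∈ c.image) (dA : Differentiable ℝ A)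
    (dB : Differentiable ℝ B) {a : Fin 2 → ℝ} (ha : a ⬝ᵥ c.k = 0) :
    divContract (c.invMetric A B) a m =
      (a ⬝ᵥ c.q * deriv A (c.X m) + a ⬝ᵥ c.r * deriv B (c.Y m)) / c.jf m := by
  have hd : ∀ i j, DifferentiableAt ℝ (fun n => c.invMetric A B n i j) m := fun i j =>
    (hasPartials_invMetric hm (dA _).hasDerivAt (dB _).hasDerivAt i j).differentiableAt
  have sym : ∀ i j, (fun n => c.invMetric A B n i j) = fun n => c.invMetric A B n j i :=
    fun i j => funext fun n => congrFun (congrFun (invMetric_transpose (m := n)) j) i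
  have h1 : ∀ i, partialDeriv i (fun z => (c.invMetric A B z *ᵥ a) i) m =
      ∑ j, partialDeriv i (fun n => c.invMetric A B n j i) m * a j := by
    intro i
    simp only [Matrix.mulVec, dotProduct]
    rw [partialDeriv, fderiv_fun_sum fun j _ => (hd i j).mul_const (a j)]
    rw [sum_apply]
    refine Finset.sum_congr rfl fun j _ => ?_
    rw [fderiv_mul_const (hd i j), partialDeriv, sym j i]
    simp [mul_comm]
  rw [divContract, Finset.sum_congr rfl fun i _ => h1 i, Finset.sum_comm]
  simp only [← Finset.sum_mul, sum_partialDeriv_invMetric_row hm dA dB]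
  simp only [dotProduct, Fin.sum_univ_two, vf, wf, v, w, Pi.add_apply, Pi.smul_apply,
    smul_eq_mul] at ha ⊢
  linear_combination (deriv A (c.X m) * c.Y m + deriv B (c.Y m) * c.X m) / c.jf m * ha

/-! ### The symplectic potential of a separable metric -/

lemma hasPartials_apply (hm : m ∈ c.image) (j : Fin 2) :
    c.HasPartials (fun n => n j) (c.vf m j) (c.wf m j) m := by
  have h : HasFDerivAt (fun n : Fin 2 → ℝ => n j) (ContinuousLinearMap.proj j) m :=
    (ContinuousLinearMap.proj (R := ℝ) (φ := fun _ : Fin 2 => ℝ) j).hasFDerivAt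
  refine h.congr_fderiv ?_
  ext n
  have e := fun i => frame_complete hm i j
  simp only [pairing_apply, dotProduct, Pi.add_apply, Pi.smul_apply, smul_eq_mul,
    ContinuousLinearMap.proj_apply]
  calc n j = ∑ i, (1 : Matrix (Fin 2) (Fin 2) ℝ) i j * n i := by
        simp [Matrix.one_apply]
    _ = _ := Finset.sum_congr rfl fun i _ => by rw [e]; ring

variable (c) in
/-- The part of the plane parametrized by the open unit square. -/
def openCell : Set (Fin 2 → ℝ) := {m ∈ c.image | c.X m ∈ Ioo (0 : ℝ) 1 ∧ c.Y m ∈ Ioo (0 : ℝ) 1}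

lemma isOpen_openCell : IsOpen c.openCell := by
  have h1 := c.contDiffOn_X.continuousOn.isOpen_inter_preimage c.isOpen_image
    (isOpen_Ioo (a := (0 : ℝ)) (b := 1))
  have h2 := c.contDiffOn_Y.continuousOn.isOpen_inter_preimage c.isOpen_image
    (isOpen_Ioo (a := (0 : ℝ)) (b := 1))
  have e : c.openCell = (c.image ∩ c.X ⁻¹' Ioo 0 1) ∩ (c.image ∩ c.Y ⁻¹' Ioo 0 1) :=
    Set.ext fun n => ⟨fun h => ⟨⟨h.1, h.2.1⟩, ⟨h.1, h.2.2⟩⟩, fun h => ⟨h.1.1, h.1.2, h.2.2⟩⟩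
  rw [e]
  exact h1.inter h2

/-- A separable metric is a Hessian: since `jac • dx` depends on `x` only, its quotient by `A`
integrates to a function of `x`, likewise for `y`, and the two primitives add up to the gradient of
the potential, a Legendre transform. -/
theorem exists_potential (hA : ContDiff ℝ ∞ A) (hB : ContDiff ℝ ∞ B)
    (pA : ∀ x ∈ Ioo (0 : ℝ) 1, 0 < A x) (pB : ∀ y ∈ Ioo (0 : ℝ) 1, 0 < B y) :
    ∃ φ : (Fin 2 → ℝ) → ℝ, ContDiffOn ℝ ∞ φ c.openCell ∧
      ∀ m ∈ c.openCell, hess φ m = c.metric A B m := by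
  have sX : ∀ j, ContDiff ℝ ∞ fun x => c.nX x j := by
    intro j
    fin_cases j <;> simp [nX, w] <;> fun_prop
  have sY : ∀ j, ContDiff ℝ ∞ fun y => c.nY y j := by
    intro j
    fin_cases j <;> simp [nY, v] <;> fun_prop
  have sub : c.openCell ⊆ c.image := fun m hm => hm.1
  choose P sP dP using fun j => exists_antideriv (h := fun x => c.nX x j / A x)
    ((sX j).contDiffOn.div hA.contDiffOn fun x hx => (pA x hx).ne')
  choose Q sQ dQ using fun j => exists_antideriv (h := fun y => c.nY y j / B y)
    ((sY j).contDiffOn.div hB.contDiffOn fun y hy => (pB y hy).ne')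
  obtain ⟨R, sR, dR⟩ := exists_antideriv
    (h := fun x => ((c.p 0 + x * c.q 0) * c.nX x 0 + (c.p 1 + x * c.q 1) * c.nX x 1) / A x)
    (ContDiffOn.div (ContDiff.contDiffOn (by have := sX 0; have := sX 1; fun_prop))
      hA.contDiffOn fun x hx => (pA x hx).ne')
  obtain ⟨S, sS, dS⟩ := exists_antideriv
    (h := fun y => ((c.p 0 + y * c.r 0) * c.nY y 0 + (c.p 1 + y * c.r 1) * c.nY y 1) / B y)
    (ContDiffOn.div (ContDiff.contDiffOn (by have := sY 0; have := sY 1; fun_prop))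
      hB.contDiffOn fun y hy => (pB y hy).ne')
  have hpt : ∀ m ∈ c.image, ∀ j,
      m j = c.p j + c.X m * c.q j + c.Y m * c.r j + c.X m * c.Y m * c.k j := fun m hm j => by
    conv_lhs => rw [← c.map_coord hm]
    rfl
  refine ⟨fun m => m 0 * (P 0 (c.X m) + Q 0 (c.Y m)) + m 1 * (P 1 (c.X m) + Q 1 (c.Y m))
    + -1 * (R (c.X m) + S (c.Y m)), ?_, ?_⟩
  · have hX := c.contDiffOn_X.mono sub
    have hY := c.contDiffOn_Y.mono sub
    have mX : MapsTo c.X c.openCell (Ioo 0 1) := fun m hm => hm.2.1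
    have mY : MapsTo c.Y c.openCell (Ioo 0 1) := fun m hm => hm.2.2
    have hap : ∀ j, ContDiffOn ℝ ∞ (fun n : Fin 2 → ℝ => n j) c.openCell := fun j =>
      (contDiff_apply ℝ ℝ j).contDiffOn
    exact (((hap 0).mul (((sP 0).comp hX mX).add ((sQ 0).comp hY mY))).add
      ((hap 1).mul (((sP 1).comp hX mX).add ((sQ 1).comp hY mY)))).add
      (contDiffOn_const.mul ((sR.comp hX mX).add (sS.comp hY mY)))
  · intro m hm
    have grad : ∀ n ∈ c.openCell, ∀ i, partialDeriv i (fun m => m 0 * (P 0 (c.X m) + Q 0 (c.Y m))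
        + m 1 * (P 1 (c.X m) + Q 1 (c.Y m)) + -1 * (R (c.X m) + S (c.Y m))) n
        = P i (c.X n) + Q i (c.Y n) := by
      intro n hn i
      have hn' := sub hn
      have h := (((hasPartials_apply hn' 0).mul
        ((hasPartials_comp_X hn' (dP 0 _ hn.2.1)).add (hasPartials_comp_Y hn' (dQ 0 _ hn.2.2)))).add
        ((hasPartials_apply hn' 1).mul
        ((hasPartials_comp_X hn' (dP 1 _ hn.2.1)).add
          (hasPartials_comp_Y hn' (dQ 1 _ hn.2.2))))).add
        ((hasPartials_const (-1) n).mul ((hasPartials_comp_X hn' (dR _ hn.2.1)).add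
          (hasPartials_comp_Y hn' (dS _ hn.2.2))))
      have e0 := frame_complete hn' i 0
      have e1 := frame_complete hn' i 1
      rw [(h.congr (a' := c.vf n 0 * (P 0 (c.X n) + Q 0 (c.Y n))
          + c.vf n 1 * (P 1 (c.X n) + Q 1 (c.Y n)))
        (b' := c.wf n 0 * (P 0 (c.X n) + Q 0 (c.Y n))
          + c.wf n 1 * (P 1 (c.X n) + Q 1 (c.Y n))) ?_ ?_).partialDeriv]
      · have hone : ∀ (t : Fin 2 → ℝ) (i : Fin 2), t i = (1 : Matrix (Fin 2) (Fin 2) ℝ) i 0 * t 0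
            + (1 : Matrix (Fin 2) (Fin 2) ℝ) i 1 * t 1 := by
          intro t i
          fin_cases i <;> simp [Matrix.one_apply]
        rw [hone (fun i => P i (c.X n) + Q i (c.Y n)) i, e0, e1]
        ring
      · have := (pA _ hn.2.1).ne'
        rw [hpt n hn' 0, hpt n hn' 1]
        field_simp
        simp [nX, w]
        ring
      · have := (pB _ hn.2.2).ne'
        rw [hpt n hn' 0, hpt n hn' 1]
        field_simp
        simp [nY, v]
        ring
    have hm' := sub hm
    have hj := jf_ne_zero hm'
    have hA0 := (pA _ hm.2.1).ne'
    have hB0 := (pB _ hm.2.2).ne'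
    ext i j
    have h := ((hasPartials_comp_X hm' (dP j _ hm.2.1)).add
      (hasPartials_comp_Y hm' (dQ j _ hm.2.2))).congr_of_eventuallyEq
      (by filter_upwards [isOpen_openCell.mem_nhds hm] with n hn using grad n hn j)
    rw [hess, Matrix.of_apply, h.partialDeriv, metric, Matrix.of_apply]
    have ex : c.nX (c.X m) j = c.jf m * c.dx m j := by
      simp only [dx]; rw [← jf]; field_simp
    have ey : c.nY (c.Y m) j = c.jf m * c.dy m j := by
      simp only [dy]; rw [← jf]; field_simp
    rw [ex, ey]
    field_simp
    ring

lemma metric_posDef (hm : m ∈ c.image) (hA : 0 < A (c.X m)) (hB : 0 < B (c.Y m)) :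
    (c.metric A B m).PosDef := by
  refine Matrix.PosDef.of_dotProduct_mulVec_pos metric_transpose fun x hx => ?_
  have hj := c.jac_coord_pos hm
  rw [← jf] at hj
  have e : star x ⬝ᵥ (c.metric A B m *ᵥ x) = c.jf m * ((c.dx m ⬝ᵥ x) ^ 2 / A (c.X m)
      + (c.dy m ⬝ᵥ x) ^ 2 / B (c.Y m)) := by
    simp [metric, Matrix.mulVec, dotProduct, Fin.sum_univ_two]
    ring
  rw [e]
  refine mul_pos hj ?_
  by_cases h0 : c.dx m ⬝ᵥ x = 0
  · have h1 : c.dy m ⬝ᵥ x ≠ 0 := by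
      intro h1
      apply hx
      ext j
      have key : x j = (c.dx m ⬝ᵥ x) * c.vf m j + (c.dy m ⬝ᵥ x) * c.wf m j := by
        have e := fun i => frame_complete hm i j
        calc x j = ∑ i, (1 : Matrix (Fin 2) (Fin 2) ℝ) i j * x i := by simp [Matrix.one_apply]
          _ = _ := by simp only [e, dotProduct, Fin.sum_univ_two]; ring
      rw [key, h0, h1]
      simp
    positivity
  · positivity

/-! ### Boundary behaviour -/

lemma dotProduct_invMetric (a b : Fin 2 → ℝ) : a ⬝ᵥ (c.invMetric A B m *ᵥ b) =
    (A (c.X m) * ((a ⬝ᵥ c.vf m) * (b ⬝ᵥ c.vf m)) + B (c.Y m) * ((a ⬝ᵥ c.wf m) * (b ⬝ᵥ c.wf m)))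
      / c.jf m := by
  simp only [invMetric, Matrix.mulVec, dotProduct, Fin.sum_univ_two, Matrix.of_apply]
  ring

lemma covector_eq (hm : m ∈ c.image) (b : Fin 2 → ℝ) :
    b = (b ⬝ᵥ c.vf m) • c.dx m + (b ⬝ᵥ c.wf m) • c.dy m := by
  ext i
  have e := frame_complete hm i
  calc b i = ∑ j, (1 : Matrix (Fin 2) (Fin 2) ℝ) i j * b j := by simp [Matrix.one_apply]
    _ = _ := by
      simp only [e, dotProduct, Fin.sum_univ_two, Pi.add_apply, Pi.smul_apply, smul_eq_mul]
      ring

lemma hasPartials_dot_vf (hm : m ∈ c.image) (b : Fin 2 → ℝ) :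
    c.HasPartials (fun n => b ⬝ᵥ c.vf n) 0 (b ⬝ᵥ c.k) m := by
  have h := ((hasPartials_const (b 0) m).mul (hasPartials_vf hm 0)).add
    ((hasPartials_const (b 1) m).mul (hasPartials_vf hm 1))
  refine (h.congr_of_eventuallyEq (Eventually.of_forall fun n => ?_)).congr ?_ ?_
  · simp only [dotProduct, Fin.sum_univ_two]
  · ring
  · simp only [dotProduct, Fin.sum_univ_two, k_eq hm]; ring

lemma hasPartials_dot_wf (hm : m ∈ c.image) (b : Fin 2 → ℝ) :
    c.HasPartials (fun n => b ⬝ᵥ c.wf n) (b ⬝ᵥ c.k) 0 m := by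
  have h := ((hasPartials_const (b 0) m).mul (hasPartials_wf hm 0)).add
    ((hasPartials_const (b 1) m).mul (hasPartials_wf hm 1))
  refine (h.congr_of_eventuallyEq (Eventually.of_forall fun n => ?_)).congr ?_ ?_
  · simp only [dotProduct, Fin.sum_univ_two]
  · simp only [dotProduct, Fin.sum_univ_two, k_eq hm]; ring
  · ring

/-- The boundary conditions along an edge of constant `x`, for the normal `(2 / A') jac dx`. -/
lemma boundary_x (hm : m ∈ c.image) (dA : Differentiable ℝ A) (dB : Differentiable ℝ B)
    (hA : A (c.X m) = 0) (hA' : deriv A (c.X m) ≠ 0) (hB : 0 < B (c.Y m)) {u : Fin 2 → ℝ}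
    (hu : u = (2 / deriv A (c.X m)) • c.nX (c.X m)) :
    c.invMetric A B m *ᵥ u = 0 ∧
    (∀ b, fderiv ℝ (fun z => u ⬝ᵥ (c.invMetric A B z *ᵥ u)) m b = 2 * (u ⬝ᵥ b)) ∧
    ∀ b, b ∉ Submodule.span ℝ {u} → 0 < b ⬝ᵥ (c.invMetric A B m *ᵥ b) := by
  have hj : 0 < c.jf m := c.jac_coord_pos hm
  have huv : u ⬝ᵥ c.vf m = 2 / deriv A (c.X m) * c.jf m := by
    rw [hu, smul_dotProduct, vf, nX_dot_v, smul_eq_mul, jf]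
  have huw : u ⬝ᵥ c.wf m = 0 := by
    rw [hu, smul_dotProduct, wf, nX_dot_w, smul_zero]
  have hux : u = (2 / deriv A (c.X m) * c.jf m) • c.dx m := by
    have := covector_eq hm u
    rwa [huv, huw, zero_smul, add_zero] at this
  refine ⟨?_, ?_, ?_⟩
  · ext i
    have := dotProduct_invMetric (c := c) (m := m) (A := A) (B := B) (Pi.single i 1) u
    rw [hA, huw] at this
    simpa using this
  · intro b
    have h := (((hasPartials_comp_X hm (dA _).hasDerivAt).mul
      ((hasPartials_dot_vf hm u).mul (hasPartials_dot_vf hm u))).add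
      ((hasPartials_comp_Y hm (dB _).hasDerivAt).mul
        ((hasPartials_dot_wf hm u).mul (hasPartials_dot_wf hm u)))).div (hasPartials_jf hm) hj.ne'
    have h' := h.congr_of_eventuallyEq (g := fun z => u ⬝ᵥ (c.invMetric A B z *ᵥ u))
      (Eventually.of_forall fun n => dotProduct_invMetric u u)
    rw [HasFDerivAt.fderiv h', pairing_apply]
    simp only [hA, huw, huv]
    rw [hux]
    simp only [add_dotProduct, smul_dotProduct, smul_eq_mul]
    field_simp
    ring
  · intro b hb
    rw [dotProduct_invMetric, hA]
    have : b ⬝ᵥ c.wf m ≠ 0 := by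
      intro h0
      apply hb
      have := covector_eq hm b
      rw [h0, zero_smul, add_zero] at this
      rw [Submodule.mem_span_singleton]
      refine ⟨(b ⬝ᵥ c.vf m) * (deriv A (c.X m) / (2 * c.jf m)), ?_⟩
      conv_rhs => rw [this]
      rw [hux, smul_smul]
      congr 1
      field_simp
    rw [zero_mul, zero_add]
    exact div_pos (mul_pos hB (mul_self_pos.2 this)) hj

/-- The boundary conditions along an edge of constant `y`, for the normal `(2 / B') jac dy`. -/
lemma boundary_y (hm : m ∈ c.image) (dA : Differentiable ℝ A) (dB : Differentiable ℝ B)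
    (hB : B (c.Y m) = 0) (hB' : deriv B (c.Y m) ≠ 0) (hA : 0 < A (c.X m)) {u : Fin 2 → ℝ}
    (hu : u = (2 / deriv B (c.Y m)) • c.nY (c.Y m)) :
    c.invMetric A B m *ᵥ u = 0 ∧
    (∀ b, fderiv ℝ (fun z => u ⬝ᵥ (c.invMetric A B z *ᵥ u)) m b = 2 * (u ⬝ᵥ b)) ∧
    ∀ b, b ∉ Submodule.span ℝ {u} → 0 < b ⬝ᵥ (c.invMetric A B m *ᵥ b) := by
  have hj : 0 < c.jf m := c.jac_coord_pos hm
  have huw : u ⬝ᵥ c.wf m = 2 / deriv B (c.Y m) * c.jf m := by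
    rw [hu, smul_dotProduct, wf, nY_dot_w, smul_eq_mul, jf]
  have huv : u ⬝ᵥ c.vf m = 0 := by
    rw [hu, smul_dotProduct, vf, nY_dot_v, smul_zero]
  have huy : u = (2 / deriv B (c.Y m) * c.jf m) • c.dy m := by
    have := covector_eq hm u
    rwa [huv, huw, zero_smul, zero_add] at this
  refine ⟨?_, ?_, ?_⟩
  · ext i
    have := dotProduct_invMetric (c := c) (m := m) (A := A) (B := B) (Pi.single i 1) u
    rw [hB, huv] at this
    simpa using this
  · intro b
    have h := (((hasPartials_comp_X hm (dA _).hasDerivAt).mul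
      ((hasPartials_dot_vf hm u).mul (hasPartials_dot_vf hm u))).add
      ((hasPartials_comp_Y hm (dB _).hasDerivAt).mul
        ((hasPartials_dot_wf hm u).mul (hasPartials_dot_wf hm u)))).div (hasPartials_jf hm) hj.ne'
    have h' := h.congr_of_eventuallyEq (g := fun z => u ⬝ᵥ (c.invMetric A B z *ᵥ u))
      (Eventually.of_forall fun n => dotProduct_invMetric u u)
    rw [HasFDerivAt.fderiv h', pairing_apply]
    simp only [hB, huw, huv]
    rw [huy]
    simp only [add_dotProduct, smul_dotProduct, smul_eq_mul]
    field_simp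
    ring
  · intro b hb
    rw [dotProduct_invMetric, hB]
    have : b ⬝ᵥ c.vf m ≠ 0 := by
      intro h0
      apply hb
      have := covector_eq hm b
      rw [h0, zero_smul, zero_add] at this
      rw [Submodule.mem_span_singleton]
      refine ⟨(b ⬝ᵥ c.wf m) * (deriv B (c.Y m) / (2 * c.jf m)), ?_⟩
      conv_rhs => rw [this]
      rw [huy, smul_smul]
      congr 1
      field_simp
    rw [zero_mul, add_zero]
    exact div_pos (mul_pos hA (mul_self_pos.2 this)) hj

end

end BilinearChart

namespace BilinearChart

variable (c : BilinearChart)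

/-! ### The quadrilateral parametrized by the unit square -/

/-- The images of the corners of the unit square, in cyclic order. -/
def vertex : Fin 4 → Fin 2 → ℝ := ![c.p, c.p + c.q, c.p + c.q + c.r + c.k, c.p + c.r]

/-- The reference labelling of the quadrilateral by the conormals `± jac dx` and `± jac dy`. -/
def normal : Fin 4 → Fin 2 → ℝ := ![c.nY 0, -c.nX 1, -c.nY 1, c.nX 0]

/-- The closed unit square. -/
def square : Set (Fin 2 → ℝ) := Set.univ.pi fun _ => Icc (0 : ℝ) 1

variable {c}

lemma mem_square {z : Fin 2 → ℝ} : z ∈ square ↔ z 0 ∈ Icc (0 : ℝ) 1 ∧ z 1 ∈ Icc (0 : ℝ) 1 := by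
  simp only [square, Set.mem_univ_pi, Fin.forall_fin_two]

lemma square_subset_domain : square ⊆ c.domain := fun _ hz =>
  c.jac_pos (mem_square.1 hz).1 (mem_square.1 hz).2

lemma X_map {z : Fin 2 → ℝ} (hz : z ∈ c.domain) : c.X (c.map z) = z 0 := by
  rw [X, c.coord_map hz]

lemma Y_map {z : Fin 2 → ℝ} (hz : z ∈ c.domain) : c.Y (c.map z) = z 1 := by
  rw [Y, c.coord_map hz]

/-- Each defining function is the coordinate that vanishes on the edge times the Jacobian at the
projection of the point to that edge along the coordinate lines, hence nonnegative on the square. -/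
lemma normal_dot_map (z : Fin 2 → ℝ) :
    c.normal 0 ⬝ᵥ (c.map z - c.vertex 0) = z 1 * c.jac (z 0) 0 ∧
    c.normal 1 ⬝ᵥ (c.map z - c.vertex 1) = (1 - z 0) * c.jac 1 (z 1) ∧
    c.normal 2 ⬝ᵥ (c.map z - c.vertex 2) = (1 - z 1) * c.jac (z 0) 1 ∧
    c.normal 3 ⬝ᵥ (c.map z - c.vertex 3) = z 0 * c.jac 0 (z 1) := by
  refine ⟨?_, ?_, ?_, ?_⟩ <;>
  · simp [normal, vertex, map, nX, nY, v, w, jac, d₀, d₁, d₂, cross, dotProduct, Fin.sum_univ_two]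
    ring

lemma isLabelling_normal : IsLabelling c.vertex c.normal := by
  have q0 : c.map ![0, 0] = c.vertex 0 := by simp [map, vertex]
  have q1 : c.map ![1, 0] = c.vertex 1 := by simp [map, vertex]
  have q2 : c.map ![1, 1] = c.vertex 2 := by simp [map, vertex]
  have q3 : c.map ![0, 1] = c.vertex 3 := by simp [map, vertex]
  have n0 := c.normal_dot_map ![0, 0]
  have n1 := c.normal_dot_map ![1, 0]
  have n2 := c.normal_dot_map ![1, 1]
  have n3 := c.normal_dot_map ![0, 1]
  rw [q0] at n0
  rw [q1] at n1
  rw [q2] at n2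
  rw [q3] at n3
  have e : ∀ x y : ℝ, x ∈ Icc (0 : ℝ) 1 → y ∈ Icc (0 : ℝ) 1 → 0 < c.jac x y :=
    fun x y hx hy => c.jac_pos hx hy
  have z0 : (0 : ℝ) ∈ Icc (0 : ℝ) 1 := by simp
  have z1 : (1 : ℝ) ∈ Icc (0 : ℝ) 1 := by simp
  have e00 := e 0 0 z0 z0
  have e01 := e 0 1 z0 z1
  have e10 := e 1 0 z1 z0
  have e11 := e 1 1 z1 z1
  simp only [Matrix.cons_val_zero, Matrix.cons_val_one, sub_self, zero_mul, one_mul,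
    sub_zero] at n0 n1 n2 n3
  intro i
  fin_cases i
  · refine ⟨n1.1, fun j h h' => ?_⟩
    fin_cases j
    · simp at h
    · simp at h'
    · exact n2.1 ▸ e10
    · exact n3.1 ▸ e00
  · refine ⟨n2.2.1, fun j h h' => ?_⟩
    fin_cases j
    · exact n0.2.1 ▸ e10
    · simp at h
    · simp at h'
    · exact n3.2.1 ▸ e11
  · refine ⟨n3.2.2.1, fun j h h' => ?_⟩
    fin_cases j
    · exact n0.2.2.1 ▸ e01
    · exact n1.2.2.1 ▸ e11
    · simp at h
    · simp at h'
  · refine ⟨n0.2.2.2, fun j h h' => ?_⟩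
    fin_cases j
    · simp at h'
    · exact n1.2.2.2 ▸ e00
    · exact n2.2.2.2 ▸ e01
    · simp at h

lemma map_mem_polytope {z : Fin 2 → ℝ} (hz : z ∈ square) : c.map z ∈ polytope c.vertex := by
  obtain ⟨⟨x0, x1⟩, ⟨y0, y1⟩⟩ := mem_square.1 hz
  have hc : Convex ℝ (polytope c.vertex) := convex_convexHull ℝ _
  have hv : ∀ i, c.vertex i ∈ polytope c.vertex := fun i =>
    subset_convexHull ℝ _ (mem_range_self i)
  have hb := hc (hv 0) (hv 1) (sub_nonneg.2 x1) x0 (by ring)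
  have ht := hc (hv 3) (hv 2) (sub_nonneg.2 x1) x0 (by ring)
  have h := hc hb ht (sub_nonneg.2 y1) y0 (by ring)
  convert h using 1
  ext i
  simp [map, vertex]
  ring

lemma normal_nonneg {m : Fin 2 → ℝ} (hm : m ∈ polytope c.vertex) (i : Fin 4) :
    0 ≤ c.normal i ⬝ᵥ (m - c.vertex i) := by
  have hconv : Convex ℝ {m : Fin 2 → ℝ | 0 ≤ c.normal i ⬝ᵥ (m - c.vertex i)} := by
    intro a ha b hb s t hs ht hst
    have e : c.normal i ⬝ᵥ (s • a + t • b - c.vertex i) =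
        s * (c.normal i ⬝ᵥ (a - c.vertex i)) + t * (c.normal i ⬝ᵥ (b - c.vertex i)) := by
      simp only [dotProduct_sub, dotProduct_add, dotProduct_smul, smul_eq_mul]
      linear_combination (c.normal i ⬝ᵥ c.vertex i) * hst
    rw [mem_ofPred_eq, e]
    exact add_nonneg (mul_nonneg hs ha) (mul_nonneg ht hb)
  refine convexHull_min ?_ hconv hm
  rintro _ ⟨j, rfl⟩
  obtain ⟨h1, h2⟩ := c.isLabelling_normal i
  by_cases hj : j = i
  · subst hj; simp
  by_cases hj' : j = i + 1
  · subst hj'; exact h1.ge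
  exact (h2 j hj hj').le

/-- A point on the inner side of all four edges has coordinates in the unit square: the
intermediate value theorem gives a line of constant `x` through it. -/
lemma exists_coord_of_nonneg {m : Fin 2 → ℝ}
    (h : ∀ i, 0 ≤ c.normal i ⬝ᵥ (m - c.vertex i)) : ∃ z ∈ square, c.map z = m := by
  have h0 := h 0
  have h1 := h 1
  have h2 := h 2
  have h3 := h 3
  have hf : ContinuousOn (fun x => c.nX x ⬝ᵥ (m - c.p - x • c.q)) (Icc 0 1) := by
    simp only [dotProduct, Fin.sum_univ_two, nX, w]
    simp
    fun_prop
  have hz : (0 : ℝ) ∈ Icc (c.nX 1 ⬝ᵥ (m - c.p - (1 : ℝ) • c.q))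
      (c.nX 0 ⬝ᵥ (m - c.p - (0 : ℝ) • c.q)) := by
    constructor
    · have : c.nX 1 ⬝ᵥ (m - c.p - (1 : ℝ) • c.q) = -(c.normal 1 ⬝ᵥ (m - c.vertex 1)) := by
        simp [normal, vertex, dotProduct, Fin.sum_univ_two]
        ring
      linarith
    · have : c.nX 0 ⬝ᵥ (m - c.p - (0 : ℝ) • c.q) = c.normal 3 ⬝ᵥ (m - c.vertex 3) := by
        simp [normal, vertex, dotProduct, Fin.sum_univ_two, nX, w]
        ring
      linarith
  obtain ⟨x, hx, hx0⟩ := intermediate_value_Icc' zero_le_one hf hz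
  have hj0 : 0 < c.jac x 0 := c.jac_pos hx (by simp)
  have hj1 : 0 < c.jac x 1 := c.jac_pos hx (by simp)
  have e := c.frame_expand hj0.ne' (m - c.p - x • c.q)
  simp only at hx0
  rw [hx0, zero_div, zero_smul, zero_add] at e
  set y := c.nY 0 ⬝ᵥ (m - c.p - x • c.q) / c.jac x 0 with hy
  have hm : c.map ![x, y] = m := by
    have : m = c.p + x • c.q + y • c.w x := by rw [e]; abel
    rw [this]
    ext i
    simp [map, w]
    ring
  obtain ⟨n0, -, n2, -⟩ := c.normal_dot_map ![x, y]
  rw [hm] at n0 n2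
  rw [n0] at h0
  rw [n2] at h2
  refine ⟨![x, y], mem_square.2 ⟨hx, ?_, ?_⟩, hm⟩
  · exact nonneg_of_mul_nonneg_left h0 hj0
  · exact sub_nonneg.1 (nonneg_of_mul_nonneg_left h2 hj1)

lemma polytope_eq_image : polytope c.vertex = c.map '' square :=
  Subset.antisymm (fun _ hm => exists_coord_of_nonneg (normal_nonneg hm))
    (image_subset_iff.2 fun _ hz => map_mem_polytope hz)

lemma mem_polytope_of_normal_nonneg {m : Fin 2 → ℝ}
    (h : ∀ i, 0 ≤ c.normal i ⬝ᵥ (m - c.vertex i)) : m ∈ polytope c.vertex := by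
  rw [polytope_eq_image]
  exact exists_coord_of_nonneg h

lemma polytope_subset_image : polytope c.vertex ⊆ c.image := by
  rw [polytope_eq_image]
  exact image_mono square_subset_domain

lemma normal_ne_zero (i : Fin 4) : c.normal i ≠ 0 := by
  intro h
  have := (c.isLabelling_normal i).2 (i + 2) (by clear h; revert i; decide)
    (by clear h; revert i; decide)
  rw [h, zero_dotProduct] at this
  exact lt_irrefl _ this

lemma normal_pos_of_mem_interior {m : Fin 2 → ℝ} (hm : m ∈ interior (polytope c.vertex))
    (i : Fin 4) : 0 < c.normal i ⬝ᵥ (m - c.vertex i) := by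
  have hn : 0 < c.normal i ⬝ᵥ c.normal i := by
    refine lt_of_le_of_ne ?_ fun h => normal_ne_zero i (dotProduct_self_eq_zero.1 h.symm)
    exact Finset.sum_nonneg fun j _ => mul_self_nonneg _
  have hcont : Tendsto (fun t : ℝ => m - t • c.normal i) (𝓝[>] 0) (𝓝 m) := by
    have : Continuous fun t : ℝ => m - t • c.normal i := by fun_prop
    have h := this.tendsto 0
    simp only [zero_smul, sub_zero] at h
    exact h.mono_left nhdsWithin_le_nhds
  obtain ⟨t, ht, ht0⟩ := ((hcont.eventually (isOpen_interior.mem_nhds hm)).and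
    self_mem_nhdsWithin).exists
  have h := normal_nonneg (interior_subset ht) i
  have e : c.normal i ⬝ᵥ (m - t • c.normal i - c.vertex i) =
      c.normal i ⬝ᵥ (m - c.vertex i) - t * (c.normal i ⬝ᵥ c.normal i) := by
    simp only [dotProduct_sub, dotProduct_smul, smul_eq_mul]
    ring
  rw [e] at h
  have := mul_pos (show (0 : ℝ) < t from ht0) hn
  linarith

lemma interior_polytope : interior (polytope c.vertex) = c.openCell := by
  apply Subset.antisymm
  · intro m hm
    have h := normal_pos_of_mem_interior hm
    obtain ⟨z, hz, rfl⟩ := exists_coord_of_nonneg fun i => (h i).le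
    have hd := square_subset_domain (c := c) hz
    obtain ⟨hx, hy⟩ := mem_square.1 hz
    obtain ⟨n0, n1, n2, n3⟩ := c.normal_dot_map z
    have h0 := n0 ▸ h 0
    have h1 := n1 ▸ h 1
    have h2 := n2 ▸ h 2
    have h3 := n3 ▸ h 3
    have i0 : (0 : ℝ) ∈ Icc (0 : ℝ) 1 := by simp
    have i1 : (1 : ℝ) ∈ Icc (0 : ℝ) 1 := by simp
    refine ⟨mem_image_of_mem _ hd, ?_, ?_⟩
    · rw [X_map hd]
      exact ⟨pos_of_mul_pos_left h3 (c.jac_pos i0 hy).le,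
        sub_pos.1 (pos_of_mul_pos_left h1 (c.jac_pos i1 hy).le)⟩
    · rw [Y_map hd]
      exact ⟨pos_of_mul_pos_left h0 (c.jac_pos hx i0).le,
        sub_pos.1 (pos_of_mul_pos_left h2 (c.jac_pos hx i1).le)⟩
  · refine interior_maximal ?_ isOpen_openCell
    intro m hm
    rw [← c.map_coord hm.1]
    exact map_mem_polytope (mem_square.2 ⟨Ioo_subset_Icc_self hm.2.1, Ioo_subset_Icc_self hm.2.2⟩)

lemma openCell_nonempty : c.openCell.Nonempty := by
  have hd : ![1 / 2, 1 / 2] ∈ c.domain := square_subset_domain (mem_square.2 (by norm_num))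
  refine ⟨c.map ![1 / 2, 1 / 2], mem_image_of_mem _ hd, ?_, ?_⟩
  · rw [X_map hd]; norm_num
  · rw [Y_map hd]; norm_num

/-- Coordinates of the points of the open edges. -/
lemma coord_of_mem_openSegment {i : Fin 4} {m : Fin 2 → ℝ}
    (hm : m ∈ openSegment ℝ (c.vertex i) (c.vertex (i + 1))) :
    m ∈ c.image ∧ (i = 0 → c.X m ∈ Ioo (0 : ℝ) 1 ∧ c.Y m = 0) ∧
      (i = 1 → c.X m = 1 ∧ c.Y m ∈ Ioo (0 : ℝ) 1) ∧ (i = 2 → c.X m ∈ Ioo (0 : ℝ) 1 ∧ c.Y m = 1) ∧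
      (i = 3 → c.X m = 0 ∧ c.Y m ∈ Ioo (0 : ℝ) 1) := by
  obtain ⟨a, b, ha, hb, hab, rfl⟩ := hm
  have ha' : a = 1 - b := by linarith
  subst ha'
  have hb1 : b < 1 := by linarith
  have hbI : b ∈ Icc (0 : ℝ) 1 := ⟨hb.le, hb1.le⟩
  have haI : 1 - b ∈ Icc (0 : ℝ) 1 := ⟨ha.le, by linarith⟩
  have i0 : (0 : ℝ) ∈ Icc (0 : ℝ) 1 := by simp
  have i1 : (1 : ℝ) ∈ Icc (0 : ℝ) 1 := by simp
  fin_cases i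
  · have hd : ![b, 0] ∈ c.domain := square_subset_domain (mem_square.2 ⟨hbI, i0⟩)
    have e : (1 - b) • c.vertex 0 + b • c.vertex 1 = c.map ![b, 0] := by
      ext i; simp [vertex, map]; ring
    simp [e, X_map hd, Y_map hd, hb, hb1]
    exact mem_image_of_mem _ hd
  · have hd : ![1, b] ∈ c.domain := square_subset_domain (mem_square.2 ⟨i1, hbI⟩)
    have e : (1 - b) • c.vertex 1 + b • c.vertex 2 = c.map ![1, b] := by
      ext i; simp [vertex, map]; ring
    simp [e, X_map hd, Y_map hd, hb, hb1]
    exact mem_image_of_mem _ hd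
  · have hd : ![1 - b, 1] ∈ c.domain := square_subset_domain (mem_square.2 ⟨haI, i1⟩)
    have e : (1 - b) • c.vertex 2 + b • c.vertex 3 = c.map ![1 - b, 1] := by
      ext i; simp [vertex, map]; ring
    simp [e, X_map hd, Y_map hd, hb, hb1]
    exact mem_image_of_mem _ hd
  · have hd : ![0, 1 - b] ∈ c.domain := square_subset_domain (mem_square.2 ⟨i0, haI⟩)
    have e : (1 - b) • c.vertex 3 + b • c.vertex 0 = c.map ![0, 1 - b] := by
      ext i; simp [vertex, map]; ring
    simp [e, X_map hd, Y_map hd, hb, hb1]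
    exact mem_image_of_mem _ hd

section

variable {A B : ℝ → ℝ}

/-- The labelling for which the separable metric with profiles `A` and `B` satisfies the boundary
conditions. -/
def labelOf (c : BilinearChart) (A B : ℝ → ℝ) : Fin 4 → Fin 2 → ℝ :=
  ![(2 / deriv B 0) • c.nY 0, (2 / deriv A 1) • c.nX 1, (2 / deriv B 1) • c.nY 1,
    (2 / deriv A 0) • c.nX 0]

/-- A separable metric whose profiles vanish at the end points, with nonzero slope, and are positive
in between has a symplectic potential for the labelling given by those slopes. -/
theorem exists_isSymplecticPotential (hA : ContDiff ℝ ∞ A) (hB : ContDiff ℝ ∞ B)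
    (pA : ∀ x ∈ Ioo (0 : ℝ) 1, 0 < A x) (pB : ∀ y ∈ Ioo (0 : ℝ) 1, 0 < B y)
    (A0 : A 0 = 0) (A1 : A 1 = 0) (B0 : B 0 = 0) (B1 : B 1 = 0)
    (A0' : deriv A 0 ≠ 0) (A1' : deriv A 1 ≠ 0) (B0' : deriv B 0 ≠ 0) (B1' : deriv B 1 ≠ 0) :
    ∃ φ, IsSymplecticPotential c.vertex (c.labelOf A B) φ (c.invMetric A B) ∧
      ∀ m ∈ interior (polytope c.vertex), hess φ m = c.metric A B m := by
  obtain ⟨φ, sφ, hφ⟩ := exists_potential (c := c) hA hB pA pB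
  have dA := hA.differentiable (by simp)
  have dB := hB.differentiable (by simp)
  rw [← interior_polytope] at sφ hφ
  have key : ∀ i, ∀ m ∈ openSegment ℝ (c.vertex i) (c.vertex (i + 1)),
      c.invMetric A B m *ᵥ c.labelOf A B i = 0 ∧
      (∀ b, fderiv ℝ (fun z => c.labelOf A B i ⬝ᵥ (c.invMetric A B z *ᵥ c.labelOf A B i)) m b
        = 2 * (c.labelOf A B i ⬝ᵥ b)) ∧
      ∀ b, b ∉ Submodule.span ℝ {c.labelOf A B i} → 0 < b ⬝ᵥ (c.invMetric A B m *ᵥ b) := by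
    intro i m hm
    obtain ⟨hi, h0, h1, h2, h3⟩ := coord_of_mem_openSegment hm
    fin_cases i
    · obtain ⟨hx, hy⟩ := h0 rfl
      exact boundary_y hi dA dB (by rw [hy, B0]) (by rw [hy]; exact B0') (pA _ hx)
        (by rw [hy]; rfl)
    · obtain ⟨hx, hy⟩ := h1 rfl
      exact boundary_x hi dA dB (by rw [hx, A1]) (by rw [hx]; exact A1') (pB _ hy)
        (by rw [hx]; rfl)
    · obtain ⟨hx, hy⟩ := h2 rfl
      exact boundary_y hi dA dB (by rw [hy, B1]) (by rw [hy]; exact B1') (pA _ hx)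
        (by rw [hy]; rfl)
    · obtain ⟨hx, hy⟩ := h3 rfl
      exact boundary_x hi dA dB (by rw [hx, A0]) (by rw [hx]; exact A0') (pB _ hy)
        (by rw [hx]; rfl)
  refine ⟨φ, ⟨sφ, ?_, ?_, ⟨c.image, c.isOpen_image, polytope_subset_image,
    contDiffOn_invMetric hA hB⟩, fun i y hy => (key i y hy).1, fun i y hy => (key i y hy).2.1,
    fun i y hy => (key i y hy).2.2⟩, hφ⟩
  · intro m hm
    rw [hφ m hm]
    rw [interior_polytope] at hm
    exact metric_posDef hm.1 (pA _ hm.2.1) (pB _ hm.2.2)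
  · intro m hm
    rw [hφ m hm]
    rw [interior_polytope] at hm
    exact (Matrix.inv_eq_right_inv (metric_mul_invMetric hm.1 (pA _ hm.2.1).ne'
      (pB _ hm.2.2).ne')).symm

end

end BilinearChart

namespace BilinearChart

variable {c : BilinearChart} {A B : ℝ → ℝ}

/-! ### The soliton equation -/

open MeasureTheory

lemma isCompact_square : IsCompact square := isCompact_univ_pi fun _ => isCompact_Icc

/-- The integral over the square of a function of one coordinate. -/
lemma setIntegral_square_apply {f : ℝ → ℝ} (hf : Continuous f) (i : Fin 2) :
    ∫ z in square, f (z i) = ∫ t in (0 : ℝ)..1, f t := by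
  have : IsProbabilityMeasure ((volume : Measure ℝ).restrict (Icc 0 1)) := ⟨by simp⟩
  rw [square, volume_pi, Measure.restrict_pi_pi,
    integral_comp_eval (μ := fun _ : Fin 2 => (volume : Measure ℝ).restrict (Icc 0 1)) (i := i)
      hf.aestronglyMeasurable, intervalIntegral.integral_of_le zero_le_one,
    integral_Icc_eq_integral_Ioc]

lemma abs_det_derivEquiv {z : Fin 2 → ℝ} (h : 0 < c.jac (z 0) (z 1)) :
    |(c.derivEquiv z h.ne' : (Fin 2 → ℝ) →L[ℝ] (Fin 2 → ℝ)).det| =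
      c.jac (z 0) (z 1) / |c.ε| := by
  have e : ((c.derivEquiv z h.ne' : (Fin 2 → ℝ) →L[ℝ] (Fin 2 → ℝ)) :
      (Fin 2 → ℝ) →ₗ[ℝ] (Fin 2 → ℝ)) = Matrix.toLin'
        !![c.v (z 1) 0, c.w (z 0) 0; c.v (z 1) 1, c.w (z 0) 1] := by
    refine LinearMap.ext fun m => ?_
    rw [Matrix.toLin'_apply]
    ext i
    fin_cases i <;> simp [derivEquiv_apply, Matrix.mulVec, dotProduct, Fin.sum_univ_two] <;> ring
  rw [ContinuousLinearMap.det, e, LinearMap.det_toLin', Matrix.det_fin_two_of,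
    eq_div_iff (abs_pos.2 c.ε_ne_zero).ne', ← abs_mul]
  have : (c.v (z 1) 0 * c.w (z 0) 1 - c.w (z 0) 0 * c.v (z 1) 1) * c.ε = c.jac (z 0) (z 1) := by
    simp [v, w, jac, d₀, d₁, d₂, cross]
    ring
  rw [this, abs_of_pos h]

lemma isCompact_polytope : IsCompact (polytope c.vertex) := by
  rw [polytope_eq_image]
  exact isCompact_square.image c.contDiff_map.continuous

/-- If the profiles vanish at the end points and satisfy the separated soliton equation with
constant `κ`, then `κ` is the mean of the scalar curvature, because the divergence term integrates
to zero over the square. -/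
lemma average_scalarCurvature (hA : ContDiff ℝ ∞ A) (hB : ContDiff ℝ ∞ B)
    (A0 : A 0 = 0) (A1 : A 1 = 0) (B0 : B 0 = 0) (B1 : B 1 = 0) {s t κ : ℝ}
    (hE : ∀ x y, deriv (deriv A) x + deriv (deriv B) y =
      2 * (s * deriv A x + t * deriv B y) - κ * c.jac x y) :
    ⨍ m in polytope c.vertex, scalarCurvature (c.invMetric A B) m = κ := by
  have hA' := (contDiff_infty_iff_deriv.1 hA).2
  have hB' := (contDiff_infty_iff_deriv.1 hB).2
  have hA'' := (contDiff_infty_iff_deriv.1 hA').2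
  have hB'' := (contDiff_infty_iff_deriv.1 hB').2
  have hcont : ContinuousOn (scalarCurvature (c.invMetric A B)) (polytope c.vertex) := by
    refine ContinuousOn.congr (f := fun m => -((deriv (deriv A) (c.X m)
      + deriv (deriv B) (c.Y m)) / c.jf m)) ?_
      fun m hm => scalarCurvature_invMetric (polytope_subset_image hm) hA hB
    refine ContinuousOn.mono ?_ polytope_subset_image
    exact (((hA''.continuous.comp_continuousOn c.contDiffOn_X.continuousOn).add
      (hB''.continuous.comp_continuousOn c.contDiffOn_Y.continuousOn)).div
      contDiffOn_jf.continuousOn fun m hm => jf_ne_zero hm).neg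
  have hint : IntegrableOn (scalarCurvature (c.invMetric A B)) (polytope c.vertex) :=
    hcont.integrableOn_compact isCompact_polytope
  have hfin : volume (polytope c.vertex) ≠ ⊤ := isCompact_polytope.measure_lt_top.ne
  have hpos : volume (polytope c.vertex) ≠ 0 := by
    intro h
    have h' : volume (c.openCell) = 0 :=
      measure_mono_null (interior_polytope (c := c) ▸ interior_subset) h
    exact (isOpen_openCell.measure_pos volume openCell_nonempty).ne' h'
  have hS : MeasurableSet square := isCompact_square.measurableSet
  have hzero : ∫ m in polytope c.vertex, (scalarCurvature (c.invMetric A B) m - κ) = 0 := by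
    rw [polytope_eq_image, integral_image_eq_integral_abs_det_fderiv_smul volume hS
      (f' := fun z => if h : 0 < c.jac (z 0) (z 1) then
        (c.derivEquiv z h.ne' : (Fin 2 → ℝ) →L[ℝ] (Fin 2 → ℝ)) else 0)
      (fun z hz => by
        rw [dif_pos (show 0 < c.jac (z 0) (z 1) from square_subset_domain hz)]
        exact (c.hasStrictFDerivAt_map z _).hasFDerivAt.hasFDerivWithinAt)
      (c.injOn_map.mono square_subset_domain)]
    have : ∀ z ∈ square, |(if h : 0 < c.jac (z 0) (z 1) then
        (c.derivEquiv z h.ne' : (Fin 2 → ℝ) →L[ℝ] (Fin 2 → ℝ)) else 0).det| •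
        (scalarCurvature (c.invMetric A B) (c.map z) - κ) =
        (-2 * s / |c.ε|) * deriv A (z 0) + (-2 * t / |c.ε|) * deriv B (z 1) := by
      intro z hz
      have hd : 0 < c.jac (z 0) (z 1) := square_subset_domain hz
      have he := (abs_pos.2 c.ε_ne_zero).ne'
      rw [dif_pos hd, abs_det_derivEquiv hd,
        scalarCurvature_invMetric (mem_image_of_mem _ hd) hA hB, hE, jf, X_map hd, Y_map hd,
        smul_eq_mul]
      field_simp
      ring
    rw [setIntegral_congr_fun hS this, integral_add, integral_const_mul, integral_const_mul,
      setIntegral_square_apply hA'.continuous, setIntegral_square_apply hB'.continuous,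
      intervalIntegral.integral_deriv_eq_sub (fun x _ => hA.differentiable (by simp) x)
        (hA'.continuous.intervalIntegrable _ _),
      intervalIntegral.integral_deriv_eq_sub (fun x _ => hB.differentiable (by simp) x)
        (hB'.continuous.intervalIntegrable _ _), A0, A1, B0, B1]
    · simp
    · exact ((hA'.continuous.comp (continuous_apply 0)).continuousOn.integrableOn_compact
        isCompact_square).const_mul _
    · exact ((hB'.continuous.comp (continuous_apply 1)).continuousOn.integrableOn_compact
        isCompact_square).const_mul _
  rw [integral_sub hint (integrableOn_const hfin), setIntegral_const] at hzero
  rw [setAverage_eq, sub_eq_zero.1 hzero, smul_smul, inv_mul_cancel₀, one_smul]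
  exact (ENNReal.toReal_pos hpos hfin).ne'

/-- The separated soliton equation. -/
theorem isGeneralizedSoliton (hA : ContDiff ℝ ∞ A) (hB : ContDiff ℝ ∞ B)
    (A0 : A 0 = 0) (A1 : A 1 = 0) (B0 : B 0 = 0) (B1 : B 1 = 0) {a : Fin 2 → ℝ}
    (ha : a ⬝ᵥ c.k = 0) {κ : ℝ}
    (hE : ∀ x y, deriv (deriv A) x + deriv (deriv B) y =
      2 * (a ⬝ᵥ c.q * deriv A x + a ⬝ᵥ c.r * deriv B y) - κ * c.jac x y) :
    IsGeneralizedSoliton c.vertex (c.invMetric A B) a := by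
  intro m hm
  have hm' := polytope_subset_image (interior_subset hm)
  have hj := jf_ne_zero hm'
  rw [average_scalarCurvature hA hB A0 A1 B0 B1 hE, scalarCurvature_invMetric hm' hA hB, hE,
    divContract_invMetric hm' (hA.differentiable (by simp)) (hB.differentiable (by simp)) ha]
  change -((_ - κ * c.jf m) / _) - _ = _
  field_simp
  ring

/-- The labelled quadrilateral given by profiles that satisfy the separated soliton equation. -/
theorem admitsSoliton (hA : ContDiff ℝ ∞ A) (hB : ContDiff ℝ ∞ B)
    (pA : ∀ x ∈ Ioo (0 : ℝ) 1, 0 < A x) (pB : ∀ y ∈ Ioo (0 : ℝ) 1, 0 < B y)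
    (A0 : A 0 = 0) (A1 : A 1 = 0) (B0 : B 0 = 0) (B1 : B 1 = 0)
    (A0' : deriv A 0 ≠ 0) (A1' : deriv A 1 ≠ 0) (B0' : deriv B 0 ≠ 0) (B1' : deriv B 1 ≠ 0)
    {a : Fin 2 → ℝ} (ha : a ⬝ᵥ c.k = 0) {κ : ℝ}
    (hE : ∀ x y, deriv (deriv A) x + deriv (deriv B) y =
      2 * (a ⬝ᵥ c.q * deriv A x + a ⬝ᵥ c.r * deriv B y) - κ * c.jac x y) :
    AdmitsSolitonWithHamiltonianTwoForm c.vertex (c.labelOf A B) a := by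
  obtain ⟨φ, h1, h2⟩ := exists_isSymplecticPotential (c := c) hA hB pA pB A0 A1 B0 B1 A0' A1' B0' B1'
  refine ⟨φ, _, h1, isGeneralizedSoliton hA hB A0 A1 B0 B1 ha hE, blockForm c.hamForm, ?_, ?_⟩
  · have hcell : ∀ m ∈ interior (polytope c.vertex), m ∈ c.openCell := fun m hm =>
      interior_polytope (c := c) ▸ hm
    exact isHamiltonianTwoForm isOpen_interior (interior_polytope (c := c) ▸ openCell_nonempty)
      (fun m hm => (hcell m hm).1) (hA.differentiable (by simp)) (hB.differentiable (by simp))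
      (fun m hm => (pA _ (hcell m hm).2.1).ne') (fun m hm => (pB _ (hcell m hm).2.2).ne') h2
  · intro p q h
    have : action p = action q := funext h
    simp only [blockForm, this]

end BilinearChart

namespace BilinearChart

variable (c : BilinearChart) (b₁ b₂ : ℝ)

/-! ### The cone of labellings -/

/-- The inverse weights of the labelling determined by the solution of the soliton equation with
parameters `(κ, e)`; the mean of its scalar curvature is `2 κ`. The quadratic polynomials in the equations of the profiles are
`-(κ d₁ / 2) x² - e x + γ` and `-(κ d₂ / 2) y² - (κ d₀ - e) y + γ'`, with `γ` and `γ'` such that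
their weighted means vanish, and the inverse weights are, up to sign, their values at the end
points. -/
def weights : ℝ × ℝ →ₗ[ℝ] (Fin 4 → ℝ) where
  toFun t := ![t.1 * c.d₂ / 2 * moment₂ b₂ + (t.1 * c.d₀ - t.2) * moment₁ b₂,
    t.1 * c.d₁ / 2 * (1 - moment₂ b₁) + t.2 * (1 - moment₁ b₁),
    t.1 * c.d₂ / 2 * (1 - moment₂ b₂) + (t.1 * c.d₀ - t.2) * (1 - moment₁ b₂),
    t.1 * c.d₁ / 2 * moment₂ b₁ + t.2 * moment₁ b₁]
  map_add' s t := by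
    ext i
    fin_cases i <;> simp <;> ring
  map_smul' s t := by
    ext i
    fin_cases i <;> simp <;> ring

lemma weights_injective : Function.Injective (c.weights b₁ b₂) := by
  rw [injective_iff_map_eq_zero]
  rintro ⟨κ, e⟩ h
  have h0 := congrFun h 0
  have h1 := congrFun h 1
  have h2 := congrFun h 2
  have h3 := congrFun h 3
  simp [weights] at h0 h1 h2 h3
  have hj : 0 < c.jac (1 / 2) (1 / 2) := c.jac_pos (by norm_num) (by norm_num)
  have hκ : κ * c.jac (1 / 2) (1 / 2) = 0 := by
    simp only [jac]
    linear_combination h0 + h1 + h2 + h3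
  have hκ0 : κ = 0 := (mul_eq_zero.1 hκ).resolve_right hj.ne'
  subst hκ0
  have he : e = 0 := by linear_combination h1 + h3
  rw [he]
  rfl

/-- Every labelling in the cone carries a soliton: positivity of the inverse weights is positivity
of the profiles. -/
lemma admitsSoliton_of_weights {a : Fin 2 → ℝ} (ha : a ⬝ᵥ c.k = 0) (t : ℝ × ℝ)
    (hw : ∀ i, 0 < c.weights (a ⬝ᵥ c.q) (a ⬝ᵥ c.r) t i) {u : Fin 4 → Fin 2 → ℝ}
    (hu : ∀ i, u i = (c.weights (a ⬝ᵥ c.q) (a ⬝ᵥ c.r) t i)⁻¹ • c.normal i) :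
    AdmitsSolitonWithHamiltonianTwoForm c.vertex u a := by
  obtain ⟨κ, e⟩ := t
  generalize hb₁ : a ⬝ᵥ c.q = b₁ at *
  generalize hb₂ : a ⬝ᵥ c.r = b₂ at *
  have w0 := hw 0
  have w1 := hw 1
  have w2 := hw 2
  have w3 := hw 3
  have u0 := hu 0
  have u1 := hu 1
  have u2 := hu 2
  have u3 := hu 3
  simp [weights] at w0 w1 w2 w3 u0 u1 u2 u3
  set α₁ := -(κ * c.d₁ / 2) with hα₁
  set α₂ := -(κ * c.d₂ / 2) with hα₂
  set β₂ := -(κ * c.d₀ - e) with hβ₂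
  set γ₁ := -(α₁ * moment₂ b₁ + -e * moment₁ b₁) with hγ₁
  set γ₂ := -(α₂ * moment₂ b₂ + β₂ * moment₁ b₂) with hγ₂
  set A := profile b₁ α₁ (-e) γ₁ with hA
  set B := profile b₂ α₂ β₂ γ₂ with hB
  have m₁ : α₁ * moment₂ b₁ + -e * moment₁ b₁ + γ₁ = 0 := by rw [hγ₁]; ring
  have m₂ : α₂ * moment₂ b₂ + β₂ * moment₁ b₂ + γ₂ = 0 := by rw [hγ₂]; ring
  have qA0 : quad α₁ (-e) γ₁ 0 = κ * c.d₁ / 2 * moment₂ b₁ + e * moment₁ b₁ := by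
    rw [quad, hγ₁, hα₁]; ring
  have qA1 : quad α₁ (-e) γ₁ 1 =
      -(κ * c.d₁ / 2 * (1 - moment₂ b₁) + e * (1 - moment₁ b₁)) := by
    rw [quad, hγ₁, hα₁]; ring
  have qB0 : quad α₂ β₂ γ₂ 0 =
      κ * c.d₂ / 2 * moment₂ b₂ + (κ * c.d₀ - e) * moment₁ b₂ := by
    rw [quad, hγ₂, hα₂, hβ₂]; ring
  have qB1 : quad α₂ β₂ γ₂ 1 =
      -(κ * c.d₂ / 2 * (1 - moment₂ b₂) + (κ * c.d₀ - e) * (1 - moment₁ b₂)) := by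
    rw [quad, hγ₂, hα₂, hβ₂]; ring
  have A0 : A 0 = 0 := profile_zero _ _ _ _
  have A1 : A 1 = 0 := profile_one m₁
  have B0 : B 0 = 0 := profile_zero _ _ _ _
  have B1 : B 1 = 0 := profile_one m₂
  have dA : ∀ x, HasDerivAt A (2 * b₁ * A x + 2 * quad α₁ (-e) γ₁ x) x :=
    hasDerivAt_profile _ _ _ _
  have dB : ∀ x, HasDerivAt B (2 * b₂ * B x + 2 * quad α₂ β₂ γ₂ x) x :=
    hasDerivAt_profile _ _ _ _
  have eA : deriv A = fun x => 2 * b₁ * A x + 2 * quad α₁ (-e) γ₁ x := funext fun x => (dA x).deriv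
  have eB : deriv B = fun x => 2 * b₂ * B x + 2 * quad α₂ β₂ γ₂ x := funext fun x => (dB x).deriv
  have ddA : ∀ x, deriv (deriv A) x = 2 * b₁ * deriv A x + 2 * (2 * α₁ * x + -e) := by
    intro x
    conv_lhs => rw [eA]
    rw [(dA x).deriv]
    exact (((dA x).const_mul (2 * b₁)).add ((hasDerivAt_quad _ _ _ x).const_mul 2)).deriv
  have ddB : ∀ x, deriv (deriv B) x = 2 * b₂ * deriv B x + 2 * (2 * α₂ * x + β₂) := by
    intro x
    conv_lhs => rw [eB]
    rw [(dB x).deriv]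
    exact (((dB x).const_mul (2 * b₂)).add ((hasDerivAt_quad _ _ _ x).const_mul 2)).deriv
  have A0' : deriv A 0 = 2 * (κ * c.d₁ / 2 * moment₂ b₁ + e * moment₁ b₁) := by
    rw [(dA 0).deriv, A0, qA0]; ring
  have A1' : deriv A 1 = -2 * (κ * c.d₁ / 2 * (1 - moment₂ b₁) + e * (1 - moment₁ b₁)) := by
    rw [(dA 1).deriv, A1, qA1]; ring
  have B0' : deriv B 0 = 2 * (κ * c.d₂ / 2 * moment₂ b₂ + (κ * c.d₀ - e) * moment₁ b₂) := by
    rw [(dB 0).deriv, B0, qB0]; ring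
  have B1' : deriv B 1 =
      -2 * (κ * c.d₂ / 2 * (1 - moment₂ b₂) + (κ * c.d₀ - e) * (1 - moment₁ b₂)) := by
    rw [(dB 1).deriv, B1, qB1]; ring
  have hlab : c.labelOf A B = u := by
    have inv2 : ∀ t : ℝ, 2 / (2 * t) = t⁻¹ := fun t => by
      rw [mul_comm, ← div_div, div_right_comm, div_self two_ne_zero, one_div]
    have inv2' : ∀ t : ℝ, 2 / (-2 * t) = -t⁻¹ := fun t => by
      rw [neg_mul, div_neg, inv2]
    ext1 i
    fin_cases i
    · change (2 / deriv B 0) • c.nY 0 = u 0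
      rw [u0, B0', inv2]; rfl
    · change (2 / deriv A 1) • c.nX 1 = u 1
      rw [u1, A1', inv2', neg_smul, ← smul_neg]; rfl
    · change (2 / deriv B 1) • c.nY 1 = u 2
      rw [u2, B1', inv2', neg_smul, ← smul_neg]; rfl
    · change (2 / deriv A 0) • c.nX 0 = u 3
      rw [u3, A0', inv2]; rfl
  rw [← hlab]
  refine admitsSoliton (contDiff_profile _ _ _ _) (contDiff_profile _ _ _ _)
    (fun x hx => profile_pos (by rw [qA0]; exact w3) (by rw [qA1]; linarith) ?_ hx)
    (fun x hx => profile_pos (by rw [qB0]; exact w0) (by rw [qB1]; linarith) ?_ hx)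
    A0 A1 B0 B1 (by rw [A0']; positivity) (by rw [A1']; linarith) (by rw [B0']; positivity)
    (by rw [B1']; linarith) ha (κ := 2 * κ) ?_
  · rw [quadInt_one, m₁, mul_zero]
  · rw [quadInt_one, m₂, mul_zero]
  · intro x y
    rw [ddA, ddB, hb₁, hb₂, hα₁, hα₂, hβ₂, jac]
    ring

/-! ### The monotone labellings -/

/-- The linear relation satisfied by the values at a point of the defining functions of the four
edges. -/
def relation (w : Fin 4 → ℝ) : ℝ :=
  c.jac 1 0 * c.jac 1 1 * w 3 + c.jac 0 0 * c.jac 0 1 * w 1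
    - c.jac 0 1 * c.jac 1 1 * w 0 - c.jac 0 0 * c.jac 1 0 * w 2

lemma relation_normal (m : Fin 2 → ℝ) :
    c.relation (fun i => c.normal i ⬝ᵥ (m - c.vertex i)) = 0 := by
  simp [relation, normal, vertex, nX, nY, v, w, jac, d₀, d₁, d₂, cross, dotProduct,
    Fin.sum_univ_two]
  ring

/-- The mean of the Jacobian for the weight `exp (-2 (b₁ x + b₂ y))` on the square. -/
def meanJac : ℝ := c.d₀ + c.d₁ * moment₁ b₁ + c.d₂ * moment₁ b₂

/-- The barycentre of the quadrilateral for the weight `exp (-2 ⟨·, a⟩)`, where `b₁` and `b₂` are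
the derivatives of `⟨·, a⟩` along the sides of the square. -/
def barycentre : Fin 2 → ℝ := c.p + (c.meanJac b₁ b₂)⁻¹ •
  ((c.d₀ * moment₁ b₁ + c.d₁ * moment₂ b₁ + c.d₂ * (moment₁ b₁ * moment₁ b₂)) • c.q
  + (c.d₀ * moment₁ b₂ + c.d₁ * (moment₁ b₁ * moment₁ b₂) + c.d₂ * moment₂ b₂) • c.r
  + (c.d₀ * (moment₁ b₁ * moment₁ b₂) + c.d₁ * (moment₂ b₁ * moment₁ b₂)
    + c.d₂ * (moment₁ b₁ * moment₂ b₂)) • c.k)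

/-- The parameters of the monotone labelling. -/
def monotoneParam : ℝ × ℝ := (2 * c.meanJac b₁ b₂, c.d₀ ^ 2 + 2 * c.d₀ * c.d₂ * moment₁ b₂
  + c.d₂ ^ 2 * moment₂ b₂ - c.d₁ ^ 2 * moment₂ b₁)

lemma meanJac_pos : 0 < c.meanJac b₁ b₂ := by
  have h : ∀ x ∈ Ioo (0 : ℝ) 1, 0 < 0 * x ^ 2 + c.d₁ * x + (c.d₀ + c.d₂ * moment₁ b₂) := by
    intro x hx
    have := quad_moment_pos (b := b₂) (α := 0) (β := c.d₂) (γ := c.d₀ + c.d₁ * x) fun y hy => by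
      have := c.jac_pos (Ioo_subset_Icc_self hx) (Ioo_subset_Icc_self hy)
      rw [jac] at this
      linarith
    linarith
  have := quad_moment_pos (b := b₁) h
  rw [meanJac]
  linarith

/-- The inverse weights of the monotone labelling are proportional to the values of the defining
functions at the weighted barycentre. -/
lemma weights_monotoneParam (i : Fin 4) : c.weights b₁ b₂ (c.monotoneParam b₁ b₂) i =
    c.meanJac b₁ b₂ * (c.normal i ⬝ᵥ (c.barycentre b₁ b₂ - c.vertex i)) := by
  have h := (c.meanJac_pos b₁ b₂).ne'
  have key : ∀ n s z : Fin 2 → ℝ, c.meanJac b₁ b₂ * (n ⬝ᵥ (c.p + (c.meanJac b₁ b₂)⁻¹ • z - s)) =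
      c.meanJac b₁ b₂ * (n ⬝ᵥ (c.p - s)) + n ⬝ᵥ z := by
    intro n s z
    simp only [dotProduct_sub, dotProduct_add, dotProduct_smul, smul_eq_mul]
    field_simp
    ring
  rw [barycentre, key]
  fin_cases i <;>
  · simp [weights, monotoneParam, meanJac, normal, vertex, nX, nY, v, w, d₀, d₁, d₂, cross,
      dotProduct, Fin.sum_univ_two]
    ring

/-- The inverse weights of the monotone labelling are the weighted means of the products of the
defining functions with the Jacobian, hence positive. -/
lemma weights_monotoneParam_pos (i : Fin 4) :
    0 < c.weights b₁ b₂ (c.monotoneParam b₁ b₂) i := by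
  have i0 : (0 : ℝ) ∈ Icc (0 : ℝ) 1 := by simp
  have i1 : (1 : ℝ) ∈ Icc (0 : ℝ) 1 := by simp
  fin_cases i
  · have h : ∀ y ∈ Ioo (0 : ℝ) 1, 0 < c.d₂ * (c.d₀ + c.d₁ * moment₁ b₁) * y ^ 2
        + (c.d₀ ^ 2 + 2 * c.d₀ * c.d₁ * moment₁ b₁ + c.d₁ ^ 2 * moment₂ b₁) * y + 0 := by
      intro y hy
      have := quad_moment_pos (b := b₁) (α := y * c.d₁ ^ 2)
        (β := y * (2 * c.d₀ * c.d₁ + c.d₁ * c.d₂ * y)) (γ := y * c.d₀ * (c.d₀ + c.d₂ * y))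
        fun x hx => by
          have := mul_pos (mul_pos hy.1 (c.jac_pos (Ioo_subset_Icc_self hx) i0))
            (c.jac_pos (Ioo_subset_Icc_self hx) (Ioo_subset_Icc_self hy))
          simp only [jac] at this
          linarith
      linarith
    have := quad_moment_pos (b := b₂) h
    simp [weights, monotoneParam, meanJac]
    linarith
  · have h : ∀ x ∈ Ioo (0 : ℝ) 1, 0 < -(c.d₁ * c.d₂ * moment₁ b₂ + (c.d₀ + c.d₁) * c.d₁) * x ^ 2
        + (c.d₁ * c.d₂ * moment₁ b₂ + (c.d₀ + c.d₁) * c.d₁ - (c.d₂ ^ 2 * moment₂ b₂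
          + c.d₂ * (2 * c.d₀ + c.d₁) * moment₁ b₂ + (c.d₀ + c.d₁) * c.d₀)) * x
        + (c.d₂ ^ 2 * moment₂ b₂ + c.d₂ * (2 * c.d₀ + c.d₁) * moment₁ b₂
          + (c.d₀ + c.d₁) * c.d₀) := by
      intro x hx
      have := quad_moment_pos (b := b₂) (α := (1 - x) * c.d₂ ^ 2)
        (β := (1 - x) * c.d₂ * (2 * c.d₀ + c.d₁ + c.d₁ * x))
        (γ := (1 - x) * (c.d₀ + c.d₁) * (c.d₀ + c.d₁ * x))
        fun y hy => by
          have := mul_pos (mul_pos (sub_pos.2 hx.2) (c.jac_pos i1 (Ioo_subset_Icc_self hy)))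
            (c.jac_pos (Ioo_subset_Icc_self hx) (Ioo_subset_Icc_self hy))
          simp only [jac] at this
          linarith
      linarith
    have := quad_moment_pos (b := b₁) h
    simp [weights, monotoneParam, meanJac]
    linarith
  · have h : ∀ y ∈ Ioo (0 : ℝ) 1, 0 < -(c.d₁ * c.d₂ * moment₁ b₁ + (c.d₀ + c.d₂) * c.d₂) * y ^ 2
        + (c.d₁ * c.d₂ * moment₁ b₁ + (c.d₀ + c.d₂) * c.d₂ - (c.d₁ ^ 2 * moment₂ b₁
          + c.d₁ * (2 * c.d₀ + c.d₂) * moment₁ b₁ + (c.d₀ + c.d₂) * c.d₀)) * y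
        + (c.d₁ ^ 2 * moment₂ b₁ + c.d₁ * (2 * c.d₀ + c.d₂) * moment₁ b₁
          + (c.d₀ + c.d₂) * c.d₀) := by
      intro y hy
      have := quad_moment_pos (b := b₁) (α := (1 - y) * c.d₁ ^ 2)
        (β := (1 - y) * c.d₁ * (2 * c.d₀ + c.d₂ + c.d₂ * y))
        (γ := (1 - y) * (c.d₀ + c.d₂) * (c.d₀ + c.d₂ * y))
        fun x hx => by
          have := mul_pos (mul_pos (sub_pos.2 hy.2) (c.jac_pos (Ioo_subset_Icc_self hx) i1))
            (c.jac_pos (Ioo_subset_Icc_self hx) (Ioo_subset_Icc_self hy))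
          simp only [jac] at this
          linarith
      linarith
    have := quad_moment_pos (b := b₂) h
    simp [weights, monotoneParam, meanJac]
    linarith
  · have h : ∀ x ∈ Ioo (0 : ℝ) 1, 0 < c.d₁ * (c.d₀ + c.d₂ * moment₁ b₂) * x ^ 2
        + (c.d₀ ^ 2 + 2 * c.d₀ * c.d₂ * moment₁ b₂ + c.d₂ ^ 2 * moment₂ b₂) * x + 0 := by
      intro x hx
      have := quad_moment_pos (b := b₂) (α := x * c.d₂ ^ 2)
        (β := x * (2 * c.d₀ * c.d₂ + c.d₁ * c.d₂ * x)) (γ := x * c.d₀ * (c.d₀ + c.d₁ * x))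
        fun y hy => by
          have := mul_pos (mul_pos hx.1 (c.jac_pos i0 (Ioo_subset_Icc_self hy)))
            (c.jac_pos (Ioo_subset_Icc_self hx) (Ioo_subset_Icc_self hy))
          simp only [jac] at this
          linarith
      linarith
    have := quad_moment_pos (b := b₁) h
    simp [weights, monotoneParam, meanJac]
    linarith

lemma moment₁_mem (b : ℝ) : 0 < moment₁ b ∧ 0 < 1 - moment₁ b := by
  constructor
  · have := quad_moment_pos (b := b) (α := 0) (β := 1) (γ := 0) fun t ht => by linarith [ht.1]
    linarith
  · have := quad_moment_pos (b := b) (α := 0) (β := -1) (γ := 1) fun t ht => by linarith [ht.2]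
    linarith

/-- The relation is not identically zero on the cone, so its kernel there is a line. -/
lemma exists_smul_of_relation {t : ℝ × ℝ} (h : c.relation (c.weights b₁ b₂ t) = 0) :
    t = (t.1 / (2 * c.meanJac b₁ b₂)) • c.monotoneParam b₁ b₂ := by
  have hm := c.meanJac_pos b₁ b₂
  have h' : c.relation (c.weights b₁ b₂ (c.monotoneParam b₁ b₂)) = 0 := by
    have := c.relation_normal (c.barycentre b₁ b₂)
    simp only [relation] at this
    simp only [relation, weights_monotoneParam]
    linear_combination c.meanJac b₁ b₂ * this
  have lin : ∀ s : ℝ × ℝ, c.relation (c.weights b₁ b₂ s) =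
      s.1 * c.relation (c.weights b₁ b₂ (1, 0)) + s.2 * c.relation (c.weights b₁ b₂ (0, 1)) := by
    intro s
    simp [relation, weights]
    ring
  have pos : 0 < c.relation (c.weights b₁ b₂ (0, 1)) := by
    have i0 : (0 : ℝ) ∈ Icc (0 : ℝ) 1 := by simp
    have i1 : (1 : ℝ) ∈ Icc (0 : ℝ) 1 := by simp
    have e00 := c.jac_pos i0 i0
    have e01 := c.jac_pos i0 i1
    have e10 := c.jac_pos i1 i0
    have e11 := c.jac_pos i1 i1
    obtain ⟨x0, x1⟩ := moment₁_mem b₁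
    obtain ⟨y0, y1⟩ := moment₁_mem b₂
    have := mul_pos (mul_pos e10 e11) x0
    have := mul_pos (mul_pos e00 e01) x1
    have := mul_pos (mul_pos e01 e11) y0
    have := mul_pos (mul_pos e00 e10) y1
    simp [relation, weights]
    linarith
  rw [lin] at h h'
  have h2 : t.2 * (2 * c.meanJac b₁ b₂) = t.1 * (c.monotoneParam b₁ b₂).2 := by
    apply mul_right_cancel₀ pos.ne'
    have e : (c.monotoneParam b₁ b₂).1 = 2 * c.meanJac b₁ b₂ := rfl
    rw [e] at h'
    linear_combination (2 * c.meanJac b₁ b₂) * h - t.1 * h'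
  ext
  · simp only [Prod.smul_fst, smul_eq_mul, monotoneParam]
    field_simp
  · simp only [Prod.smul_snd, smul_eq_mul]
    field_simp
    linarith

/-- Values of the defining functions of a rescaled labelling. -/
lemma definingFunction_smul {w : Fin 4 → ℝ} {u : Fin 4 → Fin 2 → ℝ}
    (hu : ∀ i, u i = (w i)⁻¹ • c.normal i) (i : Fin 4) (m : Fin 2 → ℝ) :
    definingFunction c.vertex u i m = (w i)⁻¹ * (c.normal i ⬝ᵥ (m - c.vertex i)) := by
  rw [definingFunction, hu, smul_dotProduct, smul_eq_mul]

lemma relation_eq_zero_of_isMonotone {w : Fin 4 → ℝ} (hw : ∀ i, 0 < w i)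
    {u : Fin 4 → Fin 2 → ℝ} (hu : ∀ i, u i = (w i)⁻¹ • c.normal i) (h : IsMonotone c.vertex u) :
    c.relation w = 0 := by
  obtain ⟨m, hm, h⟩ := h
  set l := definingFunction c.vertex u 0 m with hl
  have e : ∀ i, c.normal i ⬝ᵥ (m - c.vertex i) = l * w i := by
    intro i
    have := h 0 i
    rw [← hl, c.definingFunction_smul hu, eq_comm, inv_mul_eq_iff_eq_mul₀ (hw i).ne'] at this
    rw [this, mul_comm]
  have hr := c.relation_normal m
  simp only [relation, e] at hr
  have hr' : l * c.relation w = 0 := by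
    simp only [relation]
    linear_combination hr
  refine (mul_eq_zero.1 hr').resolve_left fun hl0 => ?_
  -- a common value zero would put the point on all four edges
  obtain ⟨z, hz, rfl⟩ := exists_coord_of_nonneg (normal_nonneg hm)
  obtain ⟨hx, hy⟩ := mem_square.1 hz
  obtain ⟨-, n1, -, n3⟩ := c.normal_dot_map z
  rw [e, hl0, zero_mul] at n1 n3
  have z3 := (mul_eq_zero.1 n3.symm).resolve_right (c.jac_pos (by simp) hy).ne'
  have z1 := (mul_eq_zero.1 n1.symm).resolve_right (c.jac_pos (by simp) hy).ne'
  linarith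

/-- For inverse weights proportional to the monotone ones, the four defining functions agree at the
weighted barycentre. -/
lemma isMonotone_of_proportional {s : ℝ} (hs : 0 < s) {u : Fin 4 → Fin 2 → ℝ}
    (hu : ∀ i, u i = (s * c.weights b₁ b₂ (c.monotoneParam b₁ b₂) i)⁻¹ • c.normal i) :
    IsMonotone c.vertex u := by
  have hm := c.meanJac_pos b₁ b₂
  have hpos : ∀ i, 0 < c.normal i ⬝ᵥ (c.barycentre b₁ b₂ - c.vertex i) := by
    intro i
    have := c.weights_monotoneParam_pos b₁ b₂ i
    rw [weights_monotoneParam] at this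
    exact pos_of_mul_pos_right this hm.le
  have e : ∀ i, definingFunction c.vertex u i (c.barycentre b₁ b₂) =
      (s * c.meanJac b₁ b₂)⁻¹ := by
    intro i
    have := (hpos i).ne'
    rw [c.definingFunction_smul hu, weights_monotoneParam]
    field_simp
  exact ⟨c.barycentre b₁ b₂, mem_polytope_of_normal_nonneg fun i => (hpos i).le,
    fun i j => by rw [e, e]⟩

/-- The cone of labellings of the quadrilateral parametrized by a bilinear chart, for a linear
function that annihilates the coefficient of `x y`. -/
theorem exists_cone {a : Fin 2 → ℝ} (ha : a ⬝ᵥ c.k = 0) :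
    ∃ C : Set (Fin 4 → Fin 2 → ℝ), IsLabelCone c.vertex 2 C ∧
      (∀ u ∈ C, AdmitsSolitonWithHamiltonianTwoForm c.vertex u a) ∧
      IsLabelCone c.vertex 1 {u ∈ C | IsMonotone c.vertex u} := by
  set b₁ := a ⬝ᵥ c.q with hb₁
  set b₂ := a ⬝ᵥ c.r with hb₂
  set w₀ := c.weights b₁ b₂ (c.monotoneParam b₁ b₂) with hw₀
  have hpos : ∀ i, 0 < w₀ i := c.weights_monotoneParam_pos b₁ b₂
  have hmem : w₀ ∈ LinearMap.range (c.weights b₁ b₂) := LinearMap.mem_range_self _ _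
  have hne : w₀ ≠ 0 := fun h => (hpos 0).ne' (by rw [h]; rfl)
  have hu₀ : (fun i => (w₀ i)⁻¹ • c.normal i) ∈ {u | ∃ w ∈ LinearMap.range (c.weights b₁ b₂),
      (∀ i, 0 < w i) ∧ ∀ i, u i = (w i)⁻¹ • c.normal i} := ⟨w₀, hmem, hpos, fun i => rfl⟩
  refine ⟨{u | ∃ w ∈ LinearMap.range (c.weights b₁ b₂), (∀ i, 0 < w i) ∧
    ∀ i, u i = (w i)⁻¹ • c.normal i}, ⟨c.normal, isLabelling_normal, _, ?_, ⟨_, hu₀⟩, rfl⟩, ?_, ?_⟩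
  · rw [LinearMap.finrank_range_of_inj (c.weights_injective b₁ b₂)]
    simp
  · rintro u ⟨_, ⟨t, rfl⟩, hw, hu⟩
    exact c.admitsSoliton_of_weights ha t hw hu
  · refine ⟨c.normal, isLabelling_normal, Submodule.span ℝ {w₀}, finrank_span_singleton hne,
      ⟨_, hu₀, c.isMonotone_of_proportional b₁ b₂ one_pos fun i => by rw [one_mul]⟩, ?_⟩
    ext u
    constructor
    · rintro ⟨⟨_, ⟨t, rfl⟩, hw, hu⟩, hmon⟩
      have ht := c.exists_smul_of_relation b₁ b₂ (c.relation_eq_zero_of_isMonotone hw hu hmon)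
      refine ⟨_, ?_, hw, hu⟩
      rw [ht, map_smul]
      exact Submodule.smul_mem _ _ (Submodule.mem_span_singleton_self _)
    · rintro ⟨w, hw, hw0, hu⟩
      obtain ⟨s, rfl⟩ := Submodule.mem_span_singleton.1 hw
      have hs : 0 < s := pos_of_mul_pos_left (hw0 0) (hpos 0).le
      exact ⟨⟨_, Submodule.smul_mem _ s hmem, hw0, hu⟩,
        c.isMonotone_of_proportional b₁ b₂ hs hu⟩

end BilinearChart

/-! ### Bilinear charts of convex quadrilaterals -/

/-- The two vertices off an edge lie on the same side of it, in terms of oriented areas. -/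
lemma cross_mul_cross_pos {n e f g : Fin 2 → ℝ} (he : e ≠ 0) (hne : n ⬝ᵥ e = 0)
    (hf : 0 < n ⬝ᵥ f) (hg : 0 < n ⬝ᵥ g) : 0 < cross e f * cross e g := by
  simp only [dotProduct, Fin.sum_univ_two] at hne hf hg
  have hT : cross e f ≠ 0 := by
    intro hT
    simp only [cross] at hT
    apply he
    have h0 : e 0 * (n 0 * f 0 + n 1 * f 1) = 0 := by linear_combination f 0 * hne + n 1 * hT
    have h1 : e 1 * (n 0 * f 0 + n 1 * f 1) = 0 := by linear_combination f 1 * hne - n 0 * hT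
    ext i
    fin_cases i
    · exact (mul_eq_zero.1 h0).resolve_right hf.ne'
    · exact (mul_eq_zero.1 h1).resolve_right hf.ne'
  have key : cross e f * (n 0 * g 0 + n 1 * g 1) = cross e g * (n 0 * f 0 + n 1 * f 1) := by
    simp only [cross]
    linear_combination -(f 0 * g 1 - f 1 * g 0) * hne
  have h : cross e f * cross e g * (n 0 * f 0 + n 1 * f 1) =
      cross e f ^ 2 * (n 0 * g 0 + n 1 * g 1) := by linear_combination -cross e f * key
  exact pos_of_mul_pos_left (h ▸ mul_pos (by positivity) hg) hf.le

lemma IsConvexQuadrilateral.cross_pos {s : Fin 4 → Fin 2 → ℝ} (hs : IsConvexQuadrilateral s)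
    (i : Fin 4) : 0 < cross (s (i + 1) - s i) (s (i + 2) - s i)
      * cross (s (i + 1) - s i) (s (i + 3) - s i) := by
  obtain ⟨n, hn, hn'⟩ := hs i
  obtain ⟨n', -, hn''⟩ := hs (i + 1)
  have d : ∀ i : Fin 4, i + 2 ≠ i ∧ i + 2 ≠ i + 1 ∧ i + 3 ≠ i ∧ i + 3 ≠ i + 1 ∧ i ≠ i + 1 ∧
      i ≠ i + 1 + 1 := by decide
  obtain ⟨d1, d2, d3, d4, d5, d6⟩ := d i
  refine cross_mul_cross_pos ?_ hn (hn' _ d1 d2) (hn' _ d3 d4)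
  intro h
  have := hn'' i d5 d6
  rw [← neg_sub, h] at this
  simp at this

/-- Every convex quadrilateral is the image of the unit square under a bilinear chart. -/
lemma IsConvexQuadrilateral.exists_chart {s : Fin 4 → Fin 2 → ℝ} (hs : IsConvexQuadrilateral s) :
    ∃ c : BilinearChart, c.vertex = s := by
  have h0 : 0 < cross (s 1 - s 0) (s 2 - s 0) * cross (s 1 - s 0) (s 3 - s 0) := hs.cross_pos 0
  have h1 : 0 < cross (s 2 - s 1) (s 3 - s 1) * cross (s 2 - s 1) (s 0 - s 1) := hs.cross_pos 1
  have h3 : 0 < cross (s 0 - s 3) (s 1 - s 3) * cross (s 0 - s 3) (s 2 - s 3) := hs.cross_pos 3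
  have e1 : cross (s 2 - s 1) (s 0 - s 1) = cross (s 1 - s 0) (s 2 - s 0) := by
    simp [cross]; ring
  have e3 : cross (s 0 - s 3) (s 1 - s 3) = cross (s 1 - s 0) (s 3 - s 0) := by
    simp [cross]; ring
  rw [e1] at h1
  rw [e3] at h3
  have hne : cross (s 1 - s 0) (s 3 - s 0) ≠ 0 := right_ne_zero_of_mul h0.ne'
  have h11 : 0 < cross (s 1 - s 0) (s 3 - s 0) * cross (s 2 - s 1) (s 3 - s 1) := by
    have h := mul_pos h0 h1
    have e : cross (s 1 - s 0) (s 2 - s 0) * cross (s 1 - s 0) (s 3 - s 0)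
        * (cross (s 2 - s 1) (s 3 - s 1) * cross (s 1 - s 0) (s 2 - s 0)) =
        cross (s 1 - s 0) (s 3 - s 0) * cross (s 2 - s 1) (s 3 - s 1)
          * cross (s 1 - s 0) (s 2 - s 0) ^ 2 := by ring
    rw [e] at h
    exact pos_of_mul_pos_left h (by positivity)
  refine ⟨⟨s 0, s 1 - s 0, s 3 - s 0, s 0 - s 1 + s 2 - s 3, cross (s 1 - s 0) (s 3 - s 0),
    mul_self_pos.2 hne, ?_, ?_, ?_⟩, ?_⟩
  · refine lt_of_lt_of_eq h0 ?_
    simp only [cross, Pi.sub_apply, Pi.add_apply]; ring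
  · refine lt_of_lt_of_eq h3 ?_
    simp only [cross, Pi.sub_apply, Pi.add_apply]; ring
  · refine lt_of_lt_of_eq h11 ?_
    simp only [cross, Pi.sub_apply, Pi.add_apply]; ring
  · ext i j
    fin_cases i <;> simp [BilinearChart.vertex]
    ring

end ToricKR

end

theorem mainTheorem5 (s : Fin 4 → Fin 2 → ℝ) (hs : ToricKR.IsConvexQuadrilateral s)
    (a : Fin 2 → ℝ) (ha : ToricKR.IsEquipoised s a) :
    ∃ C : Set (Fin 4 → Fin 2 → ℝ), ToricKR.IsLabelCone s 2 C ∧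
      (∀ u ∈ C, ToricKR.AdmitsSolitonWithHamiltonianTwoForm s u a) ∧
      ToricKR.IsLabelCone s 1 {u ∈ C | ToricKR.IsMonotone s u} := by
  obtain ⟨c, rfl⟩ := hs.exists_chart
  refine c.exists_cone ?_
  simp only [ToricKR.IsEquipoised, Fin.sum_univ_four] at ha
  simp [ToricKR.BilinearChart.vertex, dotProduct, Fin.sum_univ_two] at ha ⊢
  linear_combination ha
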